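/- Let $E,F$ be linear subspaces of $\mathbb R^d$ with $\mathbb R^d=E\oplus F$ (not necessarily orthogonal). Write $x=x_E+x_F$ with $x_E=p_E(x)\in E$, $x_F=p_F(x)\in F$, and let $x_E^\perp$, $x_F^\perp$ be the orthogonal projections of $x$ on $E$ and on $F$. Linear subspaces carry their canonical Lebesgue measures, denoted $|\cdot|$. For $V\in\{\mathbb R^d,E\}$ let $\mathcal M_\sigma(V)$ be the set of locally finite subsets of $V$ with the $\sigma$-algebra generated by the maps $N_A(\phi)=\operatorname{card}(A\cap\phi)$, $A$ bounded Borel. A point process on $V$ is a measurable map from a probability space to $\mathcal M_\sigma(V)$. It is stationary if its law is invariant under all translations $\phi\mapsto\phi-t$, $t\in V$, and square integrable if $N_K$ is square integrable for each compact $K$. Its law is ergodic under a group of translations if it is invariant under the group and each event that is a.s. invariant under each of them has probability $0$ or $1$; for a process on $V$, ergodic without further mention refers to all translations of $V$. The Palm measure of a stationary integrable point process $\phi$ on $V$ is $\mathcal C\mapsto |B|^{-1}\,\mathbb E\sum_{x\in\phi\cap B}1_{\mathcal C}(\phi-x)$, for any Borel set $B\subset V$ with $0<|B|<\infty$. The intensity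 of a measure $m$ on $\mathcal M_\sigma(V)$ is $I(m)(A)=\int\operatorname{card}(\phi\cap A)\,m(d\phi)$. The Fourier transform of a tempered measure $\mu$ on a Euclidean space is the measure $\widehat\mu$ with $\int\widehat g\,d\mu=\int g\,d\widehat\mu$ for all Schwartz functions $g$, where $\widehat g(t)=\int g(x)e^{-2\pi i\langle x,t\rangle}dx$. Let $W\subset F$ be a bounded Borel set and $\varphi$ a stationary and square integrable point process on $\mathbb R^d$ that is ergodic under the translations by vectors of $E$. Identify $E\times W$ with $\{x: x_F\in W\}$, put $\pi(\phi)=p_E(\phi\cap(E\times W))$ and $\chi=\pi(\varphi)$, and assume that a.s. two different points of $\varphi\cap(E\times W)$ have different images under $p_E$. Let $\lambda$ be the restriction to $W$ of the Lebesgue measure of $F$, let $\widetilde Q$ be the Palm measure of $\varphi$, let $C_E\subset E$ and $C_F\subset F$ be Borel sets of Lebesgue measure $1$ in $E$ and in $F$, and let $\alpha=|C_E+C_F|$ (Lebesgue measure in $\mathbb R^d$). Let $\psi=1_W*1_{-W}$ (convolution on $F$). Then: 1. $\chi$ is a stationary, ergodic and square integrable point process on $E$. 2. The map $f:W\times\mathcal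 M_\sigma(\mathbb R^d)\to\mathcal M_\sigma(E)$, $f(w,\widetilde\phi)=\pi(w+\widetilde\phi)$, is measurable, and the Palm measure of $\chi$ is the image of $\alpha\,\lambda\otimes\widetilde Q$ under $f$. 3. The intensity $\gamma$ of the Palm measure of $\chi$ is given by $$\gamma(C)=\alpha\int_{\mathbb R^d}\psi(x_F)\,1_C(x_E)\,I(\widetilde Q)(dx),\qquad C\subset E\text{ Borel}.$$ 4. $\widehat\psi\ge 0$, the measures $I(\widetilde Q)$ and $\gamma$ are tempered, their Fourier transforms are positive measures, and $$\widehat\gamma(C)=\alpha^2\int_{\mathbb R^d}\widehat\psi(x_F^\perp)\,1_C(x_E^\perp)\,\widehat{I(\widetilde Q)}(dx),\qquad C\subset E\text{ Borel}.$$ -/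

import Mathlib

open MeasureTheory Set Bornology
open scoped ENNReal Pointwise FourierTransform SchwartzMap

noncomputable section

namespace PointProc

/-! ### Locally finite configurations of points -/

/-- The space of all locally finite subsets of `V`: the subsets that have only finitely many points
in each bounded set. -/
def Config (V : Type*) [NormedAddCommGroup V] : Type _ :=
  {s : Set V // ∀ A : Set V, IsBounded A → (s ∩ A).Finite}

section Basic

variable {V : Type*} [NormedAddCommGroup V]

/-- The number `N_A φ = card (A ∩ φ)` of points of `φ` in `A` (meant for bounded `A`, where it is
finite). -/
def N (A : Set V) (φ : Config V) : ℕ := (φ.1 ∩ A).ncard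

/-- The σ-algebra on configurations generated by the counting maps `N_A`, `A` bounded Borel. -/
instance [MeasurableSpace V] : MeasurableSpace (Config V) :=
  ⨆ A : {A : Set V // IsBounded A ∧ MeasurableSet A}, MeasurableSpace.comap (N A.1) ⊤

/-- Translation of configurations: `t +ᵥ φ = {t + x | x ∈ φ}`. The map `T_t φ = φ - t` is
`φ ↦ -t +ᵥ φ`. -/
instance : VAdd V (Config V) where
  vadd t φ := ⟨t +ᵥ φ.1, by
    intro A hA
    have h : (t +ᵥ φ.1) ∩ A = t +ᵥ (φ.1 ∩ (-t +ᵥ A)) := by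
      rw [vadd_set_inter, vadd_vadd, add_neg_cancel, zero_vadd]
    rw [h]
    exact (φ.2 _ (hA.vadd (-t))).vadd_set⟩

/-- The counting measure `∑_{x ∈ φ} δ_x` of a configuration. -/
def counting [MeasurableSpace V] (φ : Config V) : Measure V :=
  Measure.sum fun x : φ.1 => Measure.dirac (x : V)

/-- The intensity measure `I(m)` of a measure on configurations,
`I(m)(A) = ∫ card (φ ∩ A) dm(φ)`; see `intensity_apply`. -/
def intensity [MeasurableSpace V] (m : Measure (Config V)) : Measure V :=
  m.bind counting

/-- Square integrability (of the law of a point process): each number of points in a compact set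
is square integrable. -/
def SquareIntegrable [MeasurableSpace V] (Q : Measure (Config V)) : Prop :=
  ∀ K : Set V, IsCompact K → MemLp (fun φ => (N K φ : ℝ)) 2 Q

end Basic

section Euclidean

/-- The canonical Lebesgue measure of a Euclidean space (the unit cube on an orthonormal basis has
measure one). For a linear subspace this is its own Lebesgue measure. -/
def lebesgue (V : Type*) [NormedAddCommGroup V] [InnerProductSpace ℝ V] [FiniteDimensional ℝ V]
    [MeasurableSpace V] [BorelSpace V] : Measure V :=
  (stdOrthonormalBasis ℝ V).toBasis.addHaar

variable {V : Type*} [NormedAddCommGroup V] [InnerProductSpace ℝ V] [FiniteDimensional ℝ V]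
  [MeasurableSpace V] [BorelSpace V]

/-- The Palm measure of (the law `Q` of) a point process, computed with the Borel set `B`:
`𝒞 ↦ |B|⁻¹ E ∑_{x ∈ φ ∩ B} 1_𝒞(φ - x)`; see `palm_apply`. -/
def palm (B : Set V) (Q : Measure (Config V)) : Measure (Config V) :=
  (lebesgue V B)⁻¹ • Q.bind fun φ =>
    Measure.sum fun x : ↥(φ.1 ∩ B) => Measure.dirac (-(x : V) +ᵥ φ)

/-- `ν` is the Fourier transform of the measure `μ`, in the sense of tempered distributions:
`∫ 𝓕 g dμ = ∫ g dν` for each Schwartz function `g`, where `𝓕 g (t) = ∫ g(x) exp(-2πi⟪x, t⟫) dx`. -/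
def IsFourierTransform (μ ν : Measure V) : Prop :=
  ∃ (_ : μ.HasTemperateGrowth) (_ : ν.HasTemperateGrowth),
    𝓕 μ.toTemperedDistribution = ν.toTemperedDistribution

/-- The function `1_W * 1_{-W}`. -/
def autoConv (W : Set V) : V → ℝ :=
  convolution (W.indicator fun _ => (1 : ℝ)) ((-W).indicator fun _ => (1 : ℝ))
    (ContinuousLinearMap.lsmul ℝ ℝ) (lebesgue V)

/-- The Fourier transform of `1_W * 1_{-W}`. -/
def autoConvFourier (W : Set V) : V → ℂ := 𝓕 fun x : V => (autoConv W x : ℂ)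

/-! ### Cut and project -/

/-- The map `π(φ) = p_E (φ ∩ (E × W))` for a decomposition `E ⊕ F` of the space and a bounded
window `W ⊆ F`, where `p_E` and `p_F` are the projections along `F` and `E`. -/
def cutProject {E F : Submodule ℝ V} (hEF : IsCompl E F) {W : Set F} (hW : IsBounded W)
    (φ : Config V) : Config E :=
  ⟨E.projectionOnto F hEF '' (φ.1 ∩ {x | F.projectionOnto E hEF.symm x ∈ W}), by
    intro A hA
    have hb : IsBounded ((((↑) : E → V) '' A) + (((↑) : F → V) '' W)) := by
      refine IsBounded.add ?_ ?_
      · exact (E.subtypeL.lipschitz.isBounded_image hA)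
      · exact (F.subtypeL.lipschitz.isBounded_image hW)
    refine ((φ.2 _ hb).image (E.projectionOnto F hEF)).subset ?_
    rintro _ ⟨⟨x, ⟨hx, hxW⟩, rfl⟩, hxA⟩
    refine ⟨x, ⟨hx, ?_⟩, rfl⟩
    exact ⟨_, ⟨_, hxA, rfl⟩, _, ⟨_, hxW, rfl⟩,
      Submodule.projection_add_projection_eq_self hEF x⟩⟩

end Euclidean

/-! ### The measures above are given by the displayed formulas -/

section Facts

variable {V : Type*} [NormedAddCommGroup V] [MeasurableSpace V]

theorem measurable_N {A : Set V} (hb : IsBounded A) (hA : MeasurableSet A) :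
    Measurable (N A : Config V → ℕ) := by
  rw [measurable_iff_comap_le]
  exact le_iSup (fun A : {A : Set V // IsBounded A ∧ MeasurableSet A} =>
    MeasurableSpace.comap (N A.1) ⊤) ⟨A, hb, hA⟩

theorem counting_apply (φ : Config V) {A : Set V} (hA : MeasurableSet A) :
    counting φ A = ((φ.1 ∩ A).encard : ℝ≥0∞) := by
  rw [counting, Measure.sum_apply _ hA]
  simp_rw [Measure.dirac_apply' _ hA]
  rw [tsum_subtype φ.1 (A.indicator (1 : V → ℝ≥0∞)), ← ENNReal.tsum_set_one,
    tsum_subtype (φ.1 ∩ A) (fun _ => (1 : ℝ≥0∞))]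
  simp only [indicator_indicator, Pi.one_def]

theorem counting_apply_of_isBounded (φ : Config V) {A : Set V} (hb : IsBounded A)
    (hA : MeasurableSet A) : counting φ A = (N A φ : ℝ≥0∞) := by
  rw [counting_apply φ hA, N, ← (φ.2 A hb).cast_ncard_eq]
  rfl

theorem counting_apply_eq_iSup (φ : Config V) (A : Set V) :
    counting φ A = ⨆ n : ℕ, counting φ (A ∩ Metric.ball 0 n) := by
  rw [← Monotone.measure_iUnion, ← inter_iUnion, Metric.iUnion_ball_nat, inter_univ]
  intro m n h
  exact inter_subset_inter_right _ (Metric.ball_subset_ball (by exact_mod_cast h))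

variable [BorelSpace V]

theorem measurable_counting : Measurable (counting : Config V → Measure V) := by
  refine Measure.measurable_of_measurable_coe _ fun A hA => ?_
  simp_rw [counting_apply_eq_iSup _ A]
  refine Measurable.iSup fun n => ?_
  have hb : IsBounded (A ∩ Metric.ball 0 n) := Metric.isBounded_ball.subset inter_subset_right
  have hm : MeasurableSet (A ∩ Metric.ball 0 n) := hA.inter Metric.isOpen_ball.measurableSet
  simp_rw [counting_apply_of_isBounded _ hb hm]
  exact (measurable_of_countable _).comp (measurable_N hb hm)

theorem intensity_apply (m : Measure (Config V)) {A : Set V} (hA : MeasurableSet A) :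
    intensity m A = ∫⁻ φ, ((φ.1 ∩ A).encard : ℝ≥0∞) ∂m := by
  rw [intensity, Measure.bind_apply hA measurable_counting.aemeasurable]
  simp_rw [counting_apply _ hA]

theorem measurable_counting_prodMk {Z : Type*} [MeasurableSpace Z] {f : Z → Config V}
    (hf : Measurable f) {t : Set (Z × V)} (ht : MeasurableSet t) :
    Measurable fun z => counting (f z) (Prod.mk z ⁻¹' t) := by
  simp_rw [fun z => counting_apply_eq_iSup (f z) (Prod.mk z ⁻¹' t)]
  refine Measurable.iSup fun n => ?_
  have hB : MeasurableSet (Metric.ball (0 : V) n) := Metric.isOpen_ball.measurableSet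
  let κ : ProbabilityTheory.Kernel Z V :=
    ProbabilityTheory.Kernel.restrict ⟨fun z => counting (f z), measurable_counting.comp hf⟩ hB
  have hκ : ∀ z, IsFiniteMeasure (κ z) := by
    intro z
    refine ⟨?_⟩
    rw [ProbabilityTheory.Kernel.restrict_apply, Measure.restrict_apply_univ]
    exact (counting_apply_of_isBounded (f z) Metric.isBounded_ball hB).trans_lt
      (ENNReal.natCast_lt_top _)
  convert ProbabilityTheory.Kernel.measurable_kernel_prodMk_left_of_finite (κ := κ) ht hκ using 2
    with z
  exact (Measure.restrict_apply (measurable_prodMk_left ht)).symm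

theorem measurable_neg_vadd [SecondCountableTopology V] :
    Measurable fun p : V × Config V => -p.1 +ᵥ p.2 := by
  refine measurable_iff_comap_le.2 ?_
  rw [instMeasurableSpaceConfig, MeasurableSpace.comap_iSup]
  refine iSup_le fun A => ?_
  rw [MeasurableSpace.comap_comp, ← measurable_iff_comap_le]
  have h1 : Measurable fun p : V × Config V =>
      counting p.2 (Prod.mk p ⁻¹' {q : (V × Config V) × V | -q.1.1 + q.2 ∈ A.1}) := by
    refine measurable_counting_prodMk measurable_snd ?_
    exact (measurable_fst.fst.neg.add measurable_snd) A.2.2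
  have h2 : ∀ p : V × Config V, N A.1 (-p.1 +ᵥ p.2) =
      (counting p.2 (Prod.mk p ⁻¹' {q : (V × Config V) × V | -q.1.1 + q.2 ∈ A.1})).toReal := by
    intro p
    have h3 : Prod.mk p ⁻¹' {q : (V × Config V) × V | -q.1.1 + q.2 ∈ A.1} = p.1 +ᵥ A.1 := by
      ext x
      simp [mem_vadd_set_iff_neg_vadd_mem]
    have h4 : (-p.1 +ᵥ p.2.1) ∩ A.1 = -p.1 +ᵥ (p.2.1 ∩ (p.1 +ᵥ A.1)) := by
      rw [vadd_set_inter, vadd_vadd, neg_add_cancel, zero_vadd]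
    rw [h3, counting_apply_of_isBounded _ (A.2.1.vadd _) (A.2.2.const_vadd _),
      ENNReal.toReal_natCast]
    norm_cast
    change ((-p.1 +ᵥ p.2.1) ∩ A.1).ncard = (p.2.1 ∩ (p.1 +ᵥ A.1)).ncard
    rw [h4, ncard_vadd_set]
  have h5 : (N A.1 ∘ fun p : V × Config V => -p.1 +ᵥ p.2) = fun p => ⌊(counting p.2
      (Prod.mk p ⁻¹' {q : (V × Config V) × V | -q.1.1 + q.2 ∈ A.1})).toReal⌋₊ := by
    funext p
    rw [← h2 p, Nat.floor_natCast]
    rfl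
  rw [h5]
  exact Nat.measurable_floor.comp h1.ennreal_toReal

end Facts

theorem palm_apply {V : Type*} [NormedAddCommGroup V] [InnerProductSpace ℝ V]
    [FiniteDimensional ℝ V] [MeasurableSpace V] [BorelSpace V] {B : Set V} (hB : MeasurableSet B)
    (Q : Measure (Config V)) {𝒞 : Set (Config V)} (h𝒞 : MeasurableSet 𝒞) :
    palm B Q 𝒞 = (lebesgue V B)⁻¹ *
      ∫⁻ φ, ∑' x : ↥(φ.1 ∩ B), 𝒞.indicator (fun _ => (1 : ℝ≥0∞)) (-(x : V) +ᵥ φ) ∂Q := by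
  have key : Measurable fun φ : Config V =>
      Measure.sum fun x : ↥(φ.1 ∩ B) => Measure.dirac (-(x : V) +ᵥ φ) := by
    refine Measure.measurable_of_measurable_coe _ fun D hD => ?_
    have h1 : MeasurableSet {q : Config V × V | q.2 ∈ B ∧ -q.2 +ᵥ q.1 ∈ D} :=
      (measurable_snd hB).inter
        ((measurable_neg_vadd.comp (measurable_snd.prodMk measurable_fst)) hD)
    convert measurable_counting_prodMk measurable_id h1 using 2 with φ
    rw [id, Measure.sum_apply _ hD, counting_apply _ (measurable_prodMk_left h1),
      ← ENNReal.tsum_set_one]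
    simp_rw [Measure.dirac_apply' _ hD]
    rw [tsum_subtype (φ.1 ∩ B) (fun x : V => D.indicator (1 : Config V → ℝ≥0∞) (-x +ᵥ φ)),
      tsum_subtype _ (fun _ : V => (1 : ℝ≥0∞))]
    refine tsum_congr fun x => ?_
    by_cases h1 : x ∈ φ.1 <;> by_cases h2 : x ∈ B <;> by_cases h3 : -x +ᵥ φ ∈ D <;>
      simp [indicator, h1, h2, h3]
  rw [palm, Measure.smul_apply, smul_eq_mul, Measure.bind_apply h𝒞 key.aemeasurable]
  congr 1
  refine lintegral_congr fun φ => ?_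
  rw [Measure.sum_apply _ h𝒞]
  simp_rw [Measure.dirac_apply' _ h𝒞]
  rfl

end PointProc

end

/-!
The projected process `χ = π(φ)` inherits stationarity, ergodicity and square integrability because
`π` is measurable, commutes with the translations by vectors of `E` (`cutProject_vadd`), and does
not increase numbers of points: `N_A(π φ) ≤ N_{A × W}(φ)`. Measurability of `π` is not immediate,
since points may merge in the projection; `π φ` has at least `k` points in `A` iff `φ` meets the
slabs over `k` disjoint basic open sets, which are countably many conditions
(`measurable_cutProject`).

By stationarity the Campbell measure of `φ` is the product of Lebesgue measure and the Palm measure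
`Q̃` (`lintegral_lintegral_counting`). Lebesgue measure of the space is `α` times the product of the
Lebesgue measures of `E` and `F` (`volume_eq_smul_map`), and the points of `χ` correspond one to one
to those of `φ` in the slab `E × W`; splitting the Campbell formula accordingly gives the Palm
measure of `χ` (`palm_map_cutProject`). Integrating `w` over the window turns it into the formula
for its intensity, in which the autocorrelation `ψ(x) = |W ∩ (W - x)|` appears
(`intensity_palm_map_cutProject`).

For the Fourier transforms, `N_A N_{A'} ≤ N_A² + N_{A'}²` bounds the mass of `I(Q̃)` on unit balls,
so `I(Q̃)` is tempered (`exists_intensity_palm_closedBall_le`). It is positive definite: the Fourier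
transform of `(1_A * 1_{-A}) I(Q̃)` at `t` is `E |∑_{x ∈ φ ∩ A} exp(2πi⟪x, t⟫)|²`
(`integral_fourierChar_autoConv`). With `A` running through the balls, normalised by volume, these
are nonnegative densities that are uniformly translation bounded; a limit point, which exists by
Prokhorov's theorem, is the Fourier transform of `I(Q̃)` (`exists_isFourierTransform`).

Finally, the inverse Fourier transform of `x ↦ a(x_F) b(x_E)` at `t` is
`α 𝓕⁻ a(t_F⊥) 𝓕⁻ b(t_E⊥)`, since the orthogonal projections are adjoint to the inclusions
(`fourierInv_tensor`). With `a = ψ` and `b = 𝓕 g` this is the formula for the Fourier transform of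
`γ`, except that `ψ` is not smooth. So the indicator of `W` is mollified, which keeps the Fourier
transforms below that of the indicator. Fatou's lemma shows that `ψ̂(x_F⊥) ν(dx)` projects to a
translation bounded measure on `E`, and dominated convergence then gives the identity
(`isFourierTransform_of_lintegral_eq`).
-/

namespace PointProc

set_option linter.unusedSectionVars false

open ProbabilityTheory Filter Topology

/-! ### Configurations and their counting kernel -/

section Counting

variable {V : Type*} [NormedAddCommGroup V]

@[simp]
theorem vadd_val (t : V) (φ : Config V) : (t +ᵥ φ).1 = t +ᵥ φ.1 := rfl

theorem N_mono {A B : Set V} (h : A ⊆ B) (hB : IsBounded B) (φ : Config V) : N A φ ≤ N B φ :=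
  ncard_le_ncard (inter_subset_inter_right _ h) (φ.2 B hB)

variable [MeasurableSpace V]

theorem measurable_toConfig {Z : Type*} [MeasurableSpace Z] {f : Z → Config V}
    (h : ∀ A : Set V, IsBounded A → MeasurableSet A → Measurable fun z => N A (f z)) :
    Measurable f := by
  refine measurable_iff_comap_le.2 ?_
  rw [instMeasurableSpaceConfig, MeasurableSpace.comap_iSup]
  refine iSup_le fun A => ?_
  rw [MeasurableSpace.comap_comp, ← measurable_iff_comap_le]
  exact h A.1 A.2.1 A.2.2

theorem lintegral_counting (φ : Config V) {g : V → ℝ≥0∞} (hg : Measurable g) :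
    ∫⁻ x, g x ∂(counting φ) = ∑' x : φ.1, g x := by
  rw [counting, lintegral_sum_measure]
  exact tsum_congr fun x => lintegral_dirac' _ hg

variable [BorelSpace V]

theorem lintegral_counting_vadd [SecondCountableTopology V] (φ : Config V) (t : V)
    {g : V → ℝ≥0∞} (hg : Measurable g) :
    ∫⁻ x, g x ∂(counting (t +ᵥ φ)) = ∫⁻ x, g (t + x) ∂(counting φ) := by
  have h1 : Measurable fun x => g (t + x) := hg.comp (measurable_const_add t)
  rw [lintegral_counting _ hg, lintegral_counting _ h1]
  let e : φ.1 ≃ (t +ᵥ φ).1 := (Equiv.addLeft t).image φ.1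
  exact (e.tsum_eq fun x : (t +ᵥ φ).1 => g x).symm

instance (φ : Config V) : SigmaFinite (counting φ) := by
  refine ⟨⟨⟨fun n => Metric.ball 0 n, fun _ => trivial, fun n => ?_, Metric.iUnion_ball_nat 0⟩⟩⟩
  rw [counting_apply_of_isBounded φ Metric.isBounded_ball Metric.isOpen_ball.measurableSet]
  exact ENNReal.natCast_lt_top _

/-- The kernel sending a configuration to its counting measure. -/
noncomputable def countingKernel (V : Type*) [NormedAddCommGroup V] [MeasurableSpace V]
    [BorelSpace V] : Kernel (Config V) V where
  toFun := counting
  measurable' := measurable_counting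

@[simp]
theorem countingKernel_apply (φ : Config V) : countingKernel V φ = counting φ := rfl

/-- The counting kernel is the sum of its restrictions to annuli, cut further according to the
number of points in the annulus, which makes every piece bounded. -/
instance : IsSFiniteKernel (countingKernel V) := by
  classical
  let D : ℕ → Set V := disjointed fun n : ℕ => Metric.ball (0 : V) n
  have hD : ∀ n, MeasurableSet (D n) := fun n =>
    MeasurableSet.disjointed (fun n => Metric.isOpen_ball.measurableSet) n
  have hDb : ∀ n, IsBounded (D n) := fun n =>
    Metric.isBounded_ball.subset (disjointed_subset (fun n : ℕ => Metric.ball (0 : V) n) n)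
  have hS : ∀ p : ℕ × ℕ, MeasurableSet {φ : Config V | N (D p.1) φ = p.2} := fun p =>
    measurable_N (hDb p.1) (hD p.1) (measurableSet_singleton p.2)
  let κ : ℕ × ℕ → Kernel (Config V) V := fun p =>
    Kernel.piecewise (hS p) ((countingKernel V).restrict (hD p.1)) 0
  have hκ : ∀ p, IsFiniteKernel (κ p) := fun p => by
    refine ⟨⟨p.2, ENNReal.natCast_lt_top _, fun φ => ?_⟩⟩
    by_cases h : N (D p.1) φ = p.2
    · rw [Kernel.piecewise_apply, if_pos (show φ ∈ {φ | N (D p.1) φ = p.2} from h),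
        Kernel.restrict_apply, Measure.restrict_apply_univ, countingKernel_apply,
        counting_apply_of_isBounded φ (hDb _) (hD _), h]
    · rw [Kernel.piecewise_apply, if_neg (show φ ∉ {φ | N (D p.1) φ = p.2} from h)]
      simp
  have key : countingKernel V = Kernel.sum κ := by
    ext φ A hA
    rw [Kernel.sum_apply' _ _ hA, ENNReal.tsum_prod']
    have h1 : ∀ n, ∑' m, κ (n, m) φ A = counting φ (A ∩ D n) := fun n => by
      rw [tsum_eq_single (N (D n) φ)]
      · rw [Kernel.piecewise_apply,
          if_pos (show φ ∈ {ψ | N (D n) ψ = N (D n) φ} from rfl),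
          Kernel.restrict_apply, Measure.restrict_apply hA, countingKernel_apply]
      · intro m hm
        rw [Kernel.piecewise_apply, if_neg (show φ ∉ {ψ | N (D n) ψ = m} from fun h => hm h.symm)]
        simp
    simp_rw [h1]
    rw [← measure_iUnion, ← inter_iUnion, iUnion_disjointed, Metric.iUnion_ball_nat, inter_univ,
      countingKernel_apply]
    · intro i j hij
      exact (disjoint_disjointed _ hij).mono inter_subset_right inter_subset_right
    · exact fun n => hA.inter (hD n)
  rw [key]
  exact Kernel.isSFiniteKernel_sum

theorem measurable_vadd_config [SecondCountableTopology V] :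
    Measurable fun p : V × Config V => p.1 +ᵥ p.2 := by
  have h := (measurable_neg_vadd (V := V)).comp (measurable_fst.neg.prodMk measurable_snd)
  convert h using 2 with p
  simp

theorem measurable_vadd_left [SecondCountableTopology V] (t : V) :
    Measurable fun φ : Config V => t +ᵥ φ :=
  measurable_vadd_config.comp (measurable_const.prodMk measurable_id)

end Counting

/-! ### The cut-and-project map -/

section CutProject

variable {V : Type*} [NormedAddCommGroup V] [InnerProductSpace ℝ V] [FiniteDimensional ℝ V]
  {E F : Submodule ℝ V} (hEF : IsCompl E F) {W : Set F}

theorem continuous_projectionOnto : Continuous (E.projectionOnto F hEF) :=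
  LinearMap.continuous_of_finiteDimensional _

/-- The set `A × W` of the points with first component in `A ⊆ E` and second component in `W`. -/
def slab (W : Set F) (A : Set E) : Set V :=
  E.projectionOnto F hEF ⁻¹' A ∩ F.projectionOnto E hEF.symm ⁻¹' W

theorem isBounded_slab (hW : IsBounded W) {A : Set E} (hA : IsBounded A) :
    IsBounded (slab hEF W A) := by
  have hb : IsBounded ((((↑) : E → V) '' A) + (((↑) : F → V) '' W)) :=
    (E.subtypeL.lipschitz.isBounded_image hA).add (F.subtypeL.lipschitz.isBounded_image hW)
  exact hb.subset fun x hx => ⟨_, ⟨_, hx.1, rfl⟩, _, ⟨_, hx.2, rfl⟩,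
    Submodule.projection_add_projection_eq_self hEF x⟩

theorem cutProject_inter (hW : IsBounded W) (φ : Config V) (A : Set E) :
    (cutProject hEF hW φ).1 ∩ A = E.projectionOnto F hEF '' (φ.1 ∩ slab hEF W A) := by
  ext y
  constructor
  · rintro ⟨⟨x, ⟨hx, hxW⟩, rfl⟩, hA⟩
    exact ⟨x, ⟨hx, hA, hxW⟩, rfl⟩
  · rintro ⟨x, ⟨hx, hA, hxW⟩, rfl⟩
    exact ⟨⟨x, ⟨hx, hxW⟩, rfl⟩, hA⟩

theorem N_cutProject_le (hW : IsBounded W) (φ : Config V) {A : Set E} (hA : IsBounded A) :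
    N A (cutProject hEF hW φ) ≤ N (slab hEF W A) φ := by
  rw [N, cutProject_inter]
  exact ncard_image_le (φ.2 _ (isBounded_slab hEF hW hA))

/-- The cut-and-project map commutes with the translations by vectors of `E`. -/
theorem cutProject_vadd (hW : IsBounded W) (t : E) (φ : Config V) :
    cutProject hEF hW ((t : V) +ᵥ φ) = t +ᵥ cutProject hEF hW φ := by
  have h1 : ∀ x : V, E.projectionOnto F hEF ((t : V) + x) = t + E.projectionOnto F hEF x := by
    intro x
    rw [map_add, Submodule.projectionOnto_apply_left]
  have h2 : ∀ x : V,
      F.projectionOnto E hEF.symm ((t : V) + x) = F.projectionOnto E hEF.symm x := by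
    intro x
    rw [map_add, Submodule.projectionOnto_apply_right, zero_add]
  apply Subtype.ext
  ext y
  simp only [cutProject, vadd_val, mem_image, mem_inter_iff, mem_vadd_set, vadd_eq_add]
  constructor
  · rintro ⟨_, ⟨⟨x, hx, rfl⟩, hW⟩, rfl⟩
    exact ⟨_, ⟨x, ⟨hx, by simpa [h2] using hW⟩, rfl⟩, (h1 x).symm⟩
  · rintro ⟨_, ⟨x, ⟨hx, hW⟩, rfl⟩, rfl⟩
    exact ⟨_, ⟨⟨x, hx, rfl⟩, by simpa [h2] using hW⟩, h1 x⟩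

variable [MeasurableSpace V] [BorelSpace V]

theorem measurable_projectionOnto : Measurable (E.projectionOnto F hEF) :=
  (continuous_projectionOnto hEF).measurable

theorem measurableSet_slab (hWm : MeasurableSet W) {A : Set E} (hA : MeasurableSet A) :
    MeasurableSet (slab hEF W A) :=
  (measurable_projectionOnto hEF hA).inter (measurable_projectionOnto hEF.symm hWm)

/-- A finite set has at least `k` points iff it meets each set of some family of `k` pairwise
disjoint basic open sets. -/
theorem le_ncard_iff_exists_countableBasis {X : Type*} [TopologicalSpace X] [T2Space X]
    [SecondCountableTopology X] {T : Set X} (hT : T.Finite) (k : ℕ) :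
    k ≤ T.ncard ↔ ∃ U : Fin k → TopologicalSpace.countableBasis X,
      Pairwise (fun i j => Disjoint (U i : Set X) (U j)) ∧ ∀ i, (T ∩ U i).Nonempty := by
  constructor
  · intro hk
    obtain ⟨O, hO, hOd⟩ := hT.t2_separation
    obtain ⟨S, hST, hS⟩ := Set.exists_subset_card_eq hk
    have hSf : Finite S := hT.subset hST
    let e : Fin k ≃ S := (Finite.equivFinOfCardEq (by rw [Nat.card_coe_set_eq, hS])).symm
    have h1 : ∀ x : X, ∃ u : TopologicalSpace.countableBasis X,
        x ∈ (u : Set X) ∧ (u : Set X) ⊆ O x :=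
      fun x => by
        obtain ⟨u, hu, hxu, huO⟩ :=
          (TopologicalSpace.isBasis_countableBasis X).exists_subset_of_mem_open (hO x).1 (hO x).2
        exact ⟨⟨u, hu⟩, hxu, huO⟩
    choose u hu huO using h1
    refine ⟨fun i => u (e i), fun i j hij => ?_, fun i => ⟨e i, hST (e i).2, hu _⟩⟩
    refine (hOd (hST (e i).2) (hST (e j).2) ?_).mono (huO _) (huO _)
    exact fun h => hij (e.injective (Subtype.ext h))
  · rintro ⟨U, hUd, hU⟩
    choose x hx using hU
    have hinj : Function.Injective x := by
      intro i j hij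
      by_contra hne
      exact Set.disjoint_left.1 (hUd hne) (hx i).2 (hij ▸ (hx j).2)
    calc k = (range x).ncard := by
          rw [← image_univ, ncard_image_of_injective _ hinj, ncard_univ, Nat.card_fin]
      _ ≤ T.ncard := ncard_le_ncard (range_subset_iff.2 fun i => (hx i).1) hT

/-- Points may merge in the projection, so the numbers of points of `π φ` are not numbers of points
of `φ`; they are determined by which slabs over basic open sets `φ` meets. -/
theorem measurable_cutProject (hW : IsBounded W) (hWm : MeasurableSet W) :
    Measurable (cutProject hEF hW) := by
  refine measurable_toConfig fun A hA hAm => measurable_of_Ici fun k => ?_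
  have h1 : (fun φ => N A (cutProject hEF hW φ)) ⁻¹' Ici k =
      ⋃ U : {U : Fin k → TopologicalSpace.countableBasis E //
        Pairwise (fun i j => Disjoint (U i : Set E) (U j))},
        ⋂ i, {φ | N (slab hEF W (A ∩ U.1 i)) φ ≠ 0} := by
    ext φ
    rw [mem_preimage, mem_Ici, N,
      le_ncard_iff_exists_countableBasis ((cutProject hEF hW φ).2 A hA)]
    simp only [mem_iUnion, mem_iInter, Subtype.exists, exists_prop, mem_ofPred_eq]
    refine exists_congr fun U => and_congr_right fun _ => forall_congr' fun i => ?_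
    rw [inter_assoc, cutProject_inter, image_nonempty, N,
      Ne, ncard_eq_zero (φ.2 _ (isBounded_slab hEF hW (hA.subset inter_subset_left))),
      nonempty_iff_ne_empty]
  rw [h1]
  refine MeasurableSet.iUnion fun U => MeasurableSet.iInter fun i => ?_
  have hm : MeasurableSet (A ∩ U.1 i) := hAm.inter
    (TopologicalSpace.isOpen_of_mem_countableBasis (U.1 i).2).measurableSet
  exact measurable_N (isBounded_slab hEF hW (hA.subset inter_subset_left))
    (measurableSet_slab hEF hWm hm) (measurableSet_singleton 0).compl

/-- The configurations on whose slab `E × W` the projection `p_E` is injective. -/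
def injConfigs (W : Set F) : Set (Config V) :=
  {φ | InjOn (E.projectionOnto F hEF) (φ.1 ∩ {x | F.projectionOnto E hEF.symm x ∈ W})}

theorem N_cutProject_eq (hW : IsBounded W) {φ : Config V} (hφ : φ ∈ injConfigs hEF W)
    (A : Set E) : N A (cutProject hEF hW φ) = N (slab hEF W A) φ := by
  rw [N, cutProject_inter, N, InjOn.ncard_image]
  exact InjOn.mono (inter_subset_inter_right _ inter_subset_right) hφ

theorem measurableSet_injConfigs (hW : IsBounded W) (hWm : MeasurableSet W) :
    MeasurableSet (injConfigs hEF W) := by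
  have h1 : injConfigs hEF W = ⋂ n : ℕ, {φ : Config V |
      N (Metric.ball (0 : E) n) (cutProject hEF hW φ) =
        N (slab hEF W (Metric.ball (0 : E) n)) φ} := by
    ext φ
    rw [mem_iInter]
    refine ⟨fun h n => N_cutProject_eq hEF hW h _, fun h x hx y hy hxy => ?_⟩
    obtain ⟨n, hn⟩ := exists_nat_gt ‖E.projectionOnto F hEF x‖
    have h2 := h n
    rw [mem_ofPred_eq, N, cutProject_inter, N,
      ncard_image_iff (φ.2 _ (isBounded_slab hEF hW Metric.isBounded_ball))] at h2
    refine h2 ⟨hx.1, ?_, hx.2⟩ ⟨hy.1, ?_, hy.2⟩ hxy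
    · simpa using hn
    · rw [mem_preimage, ← hxy]
      simpa using hn
  rw [h1]
  refine MeasurableSet.iInter fun n => measurableSet_eq_fun ?_ ?_
  · exact (measurable_N Metric.isBounded_ball Metric.isOpen_ball.measurableSet).comp
      (measurable_cutProject hEF hW hWm)
  · exact measurable_N (isBounded_slab hEF hW Metric.isBounded_ball)
      (measurableSet_slab hEF hWm Metric.isOpen_ball.measurableSet)

theorem vadd_mem_injConfigs (t : E) {φ : Config V} (hφ : φ ∈ injConfigs hEF W) :
    (t : V) +ᵥ φ ∈ injConfigs hEF W := by
  rintro _ ⟨⟨x, hx, rfl⟩, hxW⟩ _ ⟨⟨y, hy, rfl⟩, hyW⟩ hxy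
  simp only [vadd_eq_add, map_add, mem_ofPred_eq, Submodule.projectionOnto_apply_right,
    zero_add] at hxW hyW hxy
  simp only [vadd_eq_add]
  rw [hφ ⟨hx, hxW⟩ ⟨hy, hyW⟩ (add_left_cancel hxy)]

/-- The counting measure of the projected configuration is the projection of the counting measure
on the slab. -/
theorem lintegral_counting_cutProject (hW : IsBounded W) (hWm : MeasurableSet W) {φ : Config V}
    (hφ : φ ∈ injConfigs hEF W) {g : E → ℝ≥0∞} (hg : Measurable g) :
    ∫⁻ y, g y ∂(counting (cutProject hEF hW φ)) =
      ∫⁻ x, W.indicator (fun _ => 1) (F.projectionOnto E hEF.symm x) *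
        g (E.projectionOnto F hEF x) ∂(counting φ) := by
  have h1 : Measurable fun x : V => W.indicator (fun _ => (1 : ℝ≥0∞))
      (F.projectionOnto E hEF.symm x) * g (E.projectionOnto F hEF x) :=
    ((measurable_const.indicator hWm).comp (measurable_projectionOnto hEF.symm)).mul
      (hg.comp (measurable_projectionOnto hEF))
  rw [lintegral_counting _ hg, lintegral_counting _ h1]
  let S := φ.1 ∩ {x | F.projectionOnto E hEF.symm x ∈ W}
  have h2 : ∑' y : (cutProject hEF hW φ).1, g y = ∑' x : S, g (E.projectionOnto F hEF x) :=
    ((Equiv.Set.imageOfInjOn _ S hφ).tsum_eq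
      (fun y : (E.projectionOnto F hEF '' S : Set E) => g y)).symm
  rw [h2, tsum_subtype S fun x => g (E.projectionOnto F hEF x),
    tsum_subtype φ.1 fun x : V => W.indicator (fun _ => (1 : ℝ≥0∞))
      (F.projectionOnto E hEF.symm x) * g (E.projectionOnto F hEF x)]
  refine tsum_congr fun x => ?_
  by_cases hx : x ∈ φ.1 <;> by_cases hxW : F.projectionOnto E hEF.symm x ∈ W <;>
    simp [S, indicator, hx, hxW]

/-! ### Invariance, ergodicity and moments of the projected process -/

variable {Q : Measure (Config V)}

theorem vaddInvariant_map_cutProject (hW : IsBounded W) (hWm : MeasurableSet W)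
    (h : ∀ t : E, Q.map (fun φ => (t : V) +ᵥ φ) = Q) :
    VAddInvariantMeasure E (Config E) (Q.map (cutProject hEF hW)) := by
  have hc := measurable_cutProject hEF hW hWm
  refine ⟨fun t s hs => ?_⟩
  have h1 : cutProject hEF hW ⁻¹' ((t +ᵥ ·) ⁻¹' s) =
      (fun φ => (t : V) +ᵥ φ) ⁻¹' (cutProject hEF hW ⁻¹' s) := by
    ext φ
    simp [cutProject_vadd]
  rw [Measure.map_apply hc hs, Measure.map_apply hc (measurable_vadd_left t hs), h1,
    ← Measure.map_apply (measurable_vadd_left (t : V)) (hc hs), h]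

theorem ergodicVAdd_map_cutProject (hW : IsBounded W) (hWm : MeasurableSet W)
    (herg : ErgodicVAdd E (Config V) Q)
    (hinv : VAddInvariantMeasure E (Config E) (Q.map (cutProject hEF hW))) :
    ErgodicVAdd E (Config E) (Q.map (cutProject hEF hW)) := by
  have hc := measurable_cutProject hEF hW hWm
  refine { toVAddInvariantMeasure := hinv, aeconst_of_forall_preimage_vadd_ae_eq := ?_ }
  intro s hs hinvs
  have h1 : EventuallyConst (cutProject hEF hW ⁻¹' s) (ae Q) := by
    refine herg.aeconst_of_forall_preimage_vadd_ae_eq (hc hs) fun t => ?_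
    have h2 : (fun φ => cutProject hEF hW φ ∈ (t +ᵥ ·) ⁻¹' s) =ᵐ[Q]
        fun φ => cutProject hEF hW φ ∈ s := ae_eq_comp hc.aemeasurable (hinvs t)
    refine Eventually.mono h2 fun φ hφ => ?_
    refine Eq.trans ?_ hφ
    change (cutProject hEF hW ((t : V) +ᵥ φ) ∈ s) = _
    rw [cutProject_vadd]
    rfl
  rw [eventuallyConst_set] at h1 ⊢
  refine h1.imp (fun h => ?_) (fun h => ?_)
  · exact (ae_map_iff hc.aemeasurable hs).2 h
  · exact (ae_map_iff hc.aemeasurable hs.compl).2 h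

theorem memLp_N_of_squareIntegrable (hsq : SquareIntegrable Q) {A : Set V} (hA : IsBounded A)
    (hAm : MeasurableSet A) : MemLp (fun φ => (N A φ : ℝ)) 2 Q := by
  have hK : IsCompact (closure A) := hA.isCompact_closure
  refine (hsq _ hK).mono ?_ (Eventually.of_forall fun φ => ?_)
  · exact ((measurable_of_countable _).comp (measurable_N hA hAm)).aestronglyMeasurable
  · simpa using N_mono subset_closure hK.isBounded φ

theorem squareIntegrable_map_cutProject (hW : IsBounded W) (hWm : MeasurableSet W)
    (hsq : SquareIntegrable Q) : SquareIntegrable (Q.map (cutProject hEF hW)) := by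
  intro K hK
  have hm : Measurable fun φ : Config E => (N K φ : ℝ) :=
    (measurable_of_countable _).comp (measurable_N hK.isBounded hK.measurableSet)
  have hc := measurable_cutProject hEF hW hWm
  rw [memLp_map_measure_iff hm.aestronglyMeasurable hc.aemeasurable]
  refine (memLp_N_of_squareIntegrable hsq (isBounded_slab hEF hW hK.isBounded)
    (measurableSet_slab hEF hWm hK.measurableSet)).mono
    (hm.comp hc).aestronglyMeasurable (Eventually.of_forall fun φ => ?_)
  simpa using N_cutProject_le hEF hW φ hK.isBounded

end CutProject

/-! ### The Campbell measure of a stationary process -/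

section Campbell

variable {V : Type*} [NormedAddCommGroup V] [InnerProductSpace ℝ V] [FiniteDimensional ℝ V]
  [MeasurableSpace V] [BorelSpace V]

theorem lebesgue_eq_volume : lebesgue V = volume :=
  (stdOrthonormalBasis ℝ V).addHaar_eq_volume

/-- The Campbell measure: the image of `∑_{x ∈ φ} δ_{(x, φ - x)}` averaged over `Q`. -/
noncomputable def campbell (Q : Measure (Config V)) : Measure (V × Config V) :=
  (Q ⊗ₘ countingKernel V).map fun p : Config V × V => (p.2, -p.2 +ᵥ p.1)

theorem measurable_snd_neg_vadd : Measurable fun p : Config V × V => (p.2, -p.2 +ᵥ p.1) :=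
  measurable_snd.prodMk (measurable_neg_vadd.comp (measurable_snd.prodMk measurable_fst))

theorem measurable_lintegral_counting {Z : Type*} [MeasurableSpace Z] {f : Z → Config V}
    (hf : Measurable f) {g : Z × V → ℝ≥0∞} (hg : Measurable g) :
    Measurable fun z => ∫⁻ x, g (z, x) ∂(counting (f z)) :=
  Measurable.lintegral_kernel_prod_right' (κ := (countingKernel V).comap f hf) hg

variable {Q : Measure (Config V)}

theorem map_vadd_eq (hstat : VAddInvariantMeasure V (Config V) Q) (t : V) :
    Q.map (fun φ => t +ᵥ φ) = Q := by
  ext s hs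
  rw [Measure.map_apply (measurable_vadd_left t) hs]
  exact hstat.measure_preimage_vadd t hs

theorem lintegral_vadd_eq (hstat : VAddInvariantMeasure V (Config V) Q) (t : V)
    {G : Config V → ℝ≥0∞} (hG : Measurable G) : ∫⁻ φ, G (t +ᵥ φ) ∂Q = ∫⁻ φ, G φ ∂Q := by
  rw [← lintegral_map hG (measurable_vadd_left t), map_vadd_eq hstat]

variable [IsProbabilityMeasure Q]

theorem lintegral_campbell {h : V × Config V → ℝ≥0∞} (hh : Measurable h) :
    ∫⁻ p, h p ∂(campbell Q) = ∫⁻ φ, ∫⁻ x, h (x, -x +ᵥ φ) ∂(counting φ) ∂Q := by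
  rw [campbell, lintegral_map hh measurable_snd_neg_vadd]
  exact Measure.lintegral_compProd (hh.comp measurable_snd_neg_vadd)

theorem campbell_prod {A : Set V} (hA : MeasurableSet A) {𝒞 : Set (Config V)}
    (h𝒞 : MeasurableSet 𝒞) : campbell Q (A ×ˢ 𝒞) =
      ∫⁻ φ, ∫⁻ x, (A ×ˢ 𝒞).indicator (fun _ => 1) (x, -x +ᵥ φ) ∂(counting φ) ∂Q := by
  rw [← lintegral_campbell (measurable_const.indicator (hA.prod h𝒞)),
    lintegral_indicator_const (hA.prod h𝒞), one_mul]

theorem campbell_vadd (hstat : VAddInvariantMeasure V (Config V) Q) (t : V) {A : Set V}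
    (hA : MeasurableSet A) {𝒞 : Set (Config V)} (h𝒞 : MeasurableSet 𝒞) :
    campbell Q (((fun x => t + x) ⁻¹' A) ×ˢ 𝒞) = campbell Q (A ×ˢ 𝒞) := by
  have hm : Measurable fun p : Config V × V =>
      (A ×ˢ 𝒞).indicator (fun _ => (1 : ℝ≥0∞)) (p.2, -p.2 +ᵥ p.1) :=
    (measurable_const.indicator (hA.prod h𝒞)).comp measurable_snd_neg_vadd
  have hG : Measurable fun φ : Config V =>
      ∫⁻ x, (A ×ˢ 𝒞).indicator (fun _ => (1 : ℝ≥0∞)) (x, -x +ᵥ φ) ∂(counting φ) :=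
    measurable_lintegral_counting measurable_id hm
  rw [campbell_prod (measurable_const_add t hA) h𝒞, campbell_prod hA h𝒞,
    ← lintegral_vadd_eq hstat t hG]
  refine lintegral_congr fun φ => ?_
  have hm' : Measurable fun x : V =>
      (A ×ˢ 𝒞).indicator (fun _ => (1 : ℝ≥0∞)) (x, -x +ᵥ (t +ᵥ φ)) :=
    hm.comp measurable_prodMk_left
  rw [lintegral_counting_vadd φ t hm']
  refine lintegral_congr fun x => ?_
  have h1 : -(t + x) +ᵥ (t +ᵥ φ) = -x +ᵥ φ := by
    apply Subtype.ext
    simp only [vadd_val, vadd_vadd]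
    congr 1
    abel
  simp only [h1]
  rfl

theorem lintegral_N_lt_top (hsq : SquareIntegrable Q) {A : Set V} (hA : IsBounded A)
    (hAm : MeasurableSet A) : ∫⁻ φ, (N A φ : ℝ≥0∞) ∂Q < ∞ := by
  have h := ((memLp_N_of_squareIntegrable hsq hA hAm).integrable (by norm_num)).lintegral_lt_top
  simpa using h

theorem lintegral_N_sq_lt_top (hsq : SquareIntegrable Q) {A : Set V} (hA : IsBounded A)
    (hAm : MeasurableSet A) : ∫⁻ φ, (N A φ : ℝ≥0∞) ^ 2 ∂Q < ∞ := by
  have h := (memLp_N_of_squareIntegrable hsq hA hAm).integrable_sq.lintegral_lt_top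
  simpa [ENNReal.ofReal_pow] using h

/-- By stationarity the Campbell measure of `A × 𝒞` is proportional to the volume of `A`. -/
theorem exists_campbell_prod_eq (hstat : VAddInvariantMeasure V (Config V) Q)
    (hsq : SquareIntegrable Q) {𝒞 : Set (Config V)} (h𝒞 : MeasurableSet 𝒞) :
    ∃ c : NNReal, ∀ A : Set V, MeasurableSet A → campbell Q (A ×ˢ 𝒞) = c * volume A := by
  let M : Measure V := ((campbell Q).restrict (univ ×ˢ 𝒞)).map Prod.fst
  have hM : ∀ A, MeasurableSet A → M A = campbell Q (A ×ˢ 𝒞) := fun A hA => by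
    rw [Measure.map_apply measurable_fst hA, Measure.restrict_apply (measurable_fst hA)]
    congr 1
    ext p
    simp
  have h1 : M.IsAddLeftInvariant := ⟨fun t => by
    ext A hA
    rw [Measure.map_apply (measurable_const_add t) hA, hM _ hA, hM _ (measurable_const_add t hA),
      campbell_vadd hstat t hA h𝒞]⟩
  have h2 : IsFiniteMeasureOnCompacts M := ⟨fun K hK => by
    rw [hM _ hK.measurableSet, campbell_prod hK.measurableSet h𝒞]
    refine lt_of_le_of_lt (lintegral_mono fun φ => ?_)
      (lintegral_N_lt_top hsq hK.isBounded hK.measurableSet)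
    calc _ ≤ ∫⁻ x, K.indicator (fun _ => 1) x ∂(counting φ) := by
          refine lintegral_mono fun x => ?_
          by_cases hx : x ∈ K <;> by_cases hφ : -x +ᵥ φ ∈ 𝒞 <;> simp [indicator, hx, hφ]
      _ = N K φ := by
          rw [lintegral_indicator_const hK.measurableSet, one_mul,
            counting_apply_of_isBounded φ hK.isBounded hK.measurableSet]⟩
  refine ⟨M.addHaarScalarFactor volume, fun A hA => ?_⟩
  rw [← hM A hA]
  conv_lhs => rw [Measure.isAddLeftInvariant_eq_smul M volume]
  rfl

theorem palm_eq_campbell {B : Set V} (hB : MeasurableSet B) {𝒞 : Set (Config V)}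
    (h𝒞 : MeasurableSet 𝒞) : palm B Q 𝒞 = (volume B)⁻¹ * campbell Q (B ×ˢ 𝒞) := by
  rw [palm_apply hB Q h𝒞, lebesgue_eq_volume, campbell_prod hB h𝒞]
  congr 1
  refine lintegral_congr fun φ => ?_
  have hm : Measurable fun x : V => (B ×ˢ 𝒞).indicator (fun _ => (1 : ℝ≥0∞)) (x, -x +ᵥ φ) :=
    (measurable_const.indicator (hB.prod h𝒞)).comp
      (measurable_snd_neg_vadd.comp measurable_prodMk_left)
  rw [lintegral_counting φ hm,
    tsum_subtype φ.1 fun x : V => (B ×ˢ 𝒞).indicator (fun _ => (1 : ℝ≥0∞)) (x, -x +ᵥ φ),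
    tsum_subtype (φ.1 ∩ B) fun x : V => 𝒞.indicator (fun _ => (1 : ℝ≥0∞)) (-x +ᵥ φ)]
  refine tsum_congr fun x => ?_
  by_cases h1 : x ∈ φ.1 <;> by_cases h2 : x ∈ B <;> by_cases h3 : -x +ᵥ φ ∈ 𝒞 <;>
    simp [indicator, h1, h2, h3]

variable {B : Set V}

theorem campbell_prod_eq (hstat : VAddInvariantMeasure V (Config V) Q)
    (hsq : SquareIntegrable Q) (hB : MeasurableSet B) (hB0 : 0 < volume B) (hB1 : volume B < ∞)
    {A : Set V} (hA : MeasurableSet A) {𝒞 : Set (Config V)} (h𝒞 : MeasurableSet 𝒞) :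
    campbell Q (A ×ˢ 𝒞) = volume A * palm B Q 𝒞 := by
  obtain ⟨c, hc⟩ := exists_campbell_prod_eq hstat hsq h𝒞
  rw [palm_eq_campbell hB h𝒞, hc A hA, hc B hB, mul_comm (volume B)⁻¹, mul_assoc,
    ENNReal.mul_inv_cancel hB0.ne' hB1.ne, mul_one, mul_comm]

theorem isFiniteMeasure_palm (hstat : VAddInvariantMeasure V (Config V) Q)
    (hsq : SquareIntegrable Q) (hB : MeasurableSet B) (hB0 : 0 < volume B) (hB1 : volume B < ∞) :
    IsFiniteMeasure (palm B Q) := by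
  obtain ⟨c, hc⟩ := exists_campbell_prod_eq hstat hsq (MeasurableSet.univ (α := Config V))
  refine ⟨?_⟩
  rw [palm_eq_campbell hB MeasurableSet.univ, hc B hB]
  exact ENNReal.mul_lt_top (ENNReal.inv_lt_top.2 hB0)
    (ENNReal.mul_lt_top ENNReal.coe_lt_top hB1)

/-- **Campbell's formula**: `E ∑_{x ∈ φ} h(x, φ - x) = ∫ dx ∫ h(x, ψ) Q̃(dψ)`. -/
theorem lintegral_lintegral_counting (hstat : VAddInvariantMeasure V (Config V) Q)
    (hsq : SquareIntegrable Q) (hB : MeasurableSet B) (hB0 : 0 < volume B) (hB1 : volume B < ∞)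
    {h : V × Config V → ℝ≥0∞} (hh : Measurable h) :
    ∫⁻ φ, ∫⁻ x, h (x, -x +ᵥ φ) ∂(counting φ) ∂Q = ∫⁻ x, ∫⁻ ψ, h (x, ψ) ∂(palm B Q) := by
  have := isFiniteMeasure_palm hstat hsq hB hB0 hB1
  rw [← lintegral_campbell hh, ← Measure.prod_eq (fun A 𝒞 hA h𝒞 =>
    campbell_prod_eq hstat hsq hB hB0 hB1 hA h𝒞), lintegral_prod _ hh.aemeasurable]

theorem lintegral_intensity {m : Measure (Config V)} {g : V → ℝ≥0∞} (hg : Measurable g) :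
    ∫⁻ z, g z ∂(intensity m) = ∫⁻ ψ, ∫⁻ z, g z ∂(counting ψ) ∂m :=
  Measure.lintegral_bind measurable_counting.aemeasurable hg.aemeasurable

/-- The second moments of `φ` in terms of the intensity of the Palm measure:
`E ∑_{x, y ∈ φ} g(x, y) = ∫ dx ∫ g(x, x + z) I(Q̃)(dz)`. -/
theorem lintegral_second_moment (hstat : VAddInvariantMeasure V (Config V) Q)
    (hsq : SquareIntegrable Q) (hB : MeasurableSet B) (hB0 : 0 < volume B) (hB1 : volume B < ∞)
    {g : V × V → ℝ≥0∞} (hg : Measurable g) :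
    ∫⁻ φ, ∫⁻ x, ∫⁻ y, g (x, y) ∂(counting φ) ∂(counting φ) ∂Q =
      ∫⁻ x, ∫⁻ z, g (x, x + z) ∂(intensity (palm B Q)) := by
  have hg' : Measurable fun p : V × V => g (p.1, p.1 + p.2) :=
    hg.comp (measurable_fst.prodMk (measurable_fst.add measurable_snd))
  have hm : Measurable fun p : V × Config V => ∫⁻ z, g (p.1, p.1 + z) ∂(counting p.2) :=
    measurable_lintegral_counting measurable_snd (g := fun q => g (q.1.1, q.1.1 + q.2))
      (hg'.comp (measurable_fst.fst.prodMk measurable_snd))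
  have h1 := lintegral_lintegral_counting hstat hsq hB hB0 hB1 hm
  calc _ = ∫⁻ φ, ∫⁻ x, ∫⁻ z, g (x, x + z) ∂(counting (-x +ᵥ φ)) ∂(counting φ) ∂Q := by
        refine lintegral_congr fun φ => lintegral_congr fun x => ?_
        rw [lintegral_counting_vadd φ (-x) (g := fun z => g (x, x + z))
          (hg'.comp measurable_prodMk_left)]
        simp
    _ = _ := h1
    _ = _ := lintegral_congr fun x =>
        (lintegral_intensity (g := fun z => g (x, x + z)) (hg'.comp measurable_prodMk_left)).symm

/-- The intensity of the Palm measure of a square integrable stationary process is translation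
bounded, because `N_A N_{A'} ≤ N_A² + N_{A'}²`. -/
theorem exists_intensity_palm_closedBall_le (hstat : VAddInvariantMeasure V (Config V) Q)
    (hsq : SquareIntegrable Q) (hB : MeasurableSet B) (hB0 : 0 < volume B) (hB1 : volume B < ∞) :
    ∃ C : NNReal, ∀ t : V, intensity (palm B Q) (Metric.closedBall t 1) ≤ C := by
  let D : Set V := Metric.closedBall 0 2
  have hDm : MeasurableSet D := Metric.isClosed_closedBall.measurableSet
  have hD := lintegral_N_sq_lt_top hsq (Metric.isBounded_closedBall (x := (0 : V)) (r := 2)) hDm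
  set S := ∫⁻ φ, (N D φ : ℝ≥0∞) ^ 2 ∂Q with hS
  let A : Set V := Metric.closedBall 0 1
  have hAm : MeasurableSet A := Metric.isClosed_closedBall.measurableSet
  have hA0 : volume A ≠ 0 := (Metric.measure_closedBall_pos volume _ one_pos).ne'
  have hA1 : volume A ≠ ∞ := (isCompact_closedBall (0 : V) 1).measure_lt_top.ne
  have hc : (volume A)⁻¹ * (S + S) ≠ ∞ :=
    ENNReal.mul_ne_top (ENNReal.inv_ne_top.2 hA0) (by simp [hD.ne])
  refine ⟨((volume A)⁻¹ * (S + S)).toNNReal, fun t => ?_⟩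
  rw [ENNReal.coe_toNNReal hc]
  let T : Set V := Metric.closedBall t 1
  have hTm : MeasurableSet T := Metric.isClosed_closedBall.measurableSet
  let g : V × V → ℝ≥0∞ := fun p => A.indicator (fun _ => 1) p.1 *
    T.indicator (fun _ => 1) (p.2 - p.1)
  have hg : Measurable g :=
    ((measurable_const.indicator hAm).comp measurable_fst).mul
      ((measurable_const.indicator hTm).comp (measurable_snd.sub measurable_fst))
  have h1 := lintegral_second_moment hstat hsq hB hB0 hB1 hg
  have h2 : ∫⁻ x, ∫⁻ z, g (x, x + z) ∂(intensity (palm B Q)) =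
      volume A * intensity (palm B Q) T := by
    simp only [g, add_sub_cancel_left]
    simp_rw [lintegral_const_mul _ (measurable_const.indicator hTm),
      lintegral_indicator_const hTm, one_mul]
    rw [lintegral_mul_const _ (measurable_const.indicator hAm), lintegral_indicator_const hAm,
      one_mul]
  let D' : Set V := Metric.closedBall t 2
  have hDm' : MeasurableSet D' := Metric.isClosed_closedBall.measurableSet
  have hmN : ∀ {X : Set V}, IsBounded X → MeasurableSet X →
      Measurable fun φ : Config V => (N X φ : ℝ≥0∞) ^ 2 := fun hb hm =>
    ((measurable_of_countable _).comp (measurable_N hb hm)).pow_const 2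
  have h3 : ∫⁻ φ, ∫⁻ x, ∫⁻ y, g (x, y) ∂(counting φ) ∂(counting φ) ∂Q ≤ S + S := by
    have h4 : ∫⁻ φ, (N D' φ : ℝ≥0∞) ^ 2 ∂Q = S := by
      rw [hS, ← lintegral_vadd_eq hstat (-t) (hmN Metric.isBounded_closedBall hDm)]
      refine lintegral_congr fun φ => ?_
      have h5 : (-t +ᵥ φ.1) ∩ D = -t +ᵥ (φ.1 ∩ D') := by
        rw [vadd_set_inter]
        simp [D, D']
      rw [N, N, vadd_val, h5, ncard_vadd_set]
    calc _ ≤ ∫⁻ φ, (N D φ : ℝ≥0∞) ^ 2 + (N D' φ : ℝ≥0∞) ^ 2 ∂Q := by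
          refine lintegral_mono fun φ => ?_
          have h6 : ∀ x y, g (x, y) ≤ D.indicator (fun _ => 1) x * D'.indicator (fun _ => 1) y := by
            intro x y
            by_cases hx : x ∈ A
            · have hx' : x ∈ D := Metric.closedBall_subset_closedBall (by norm_num) hx
              by_cases hy : y - x ∈ T
              · have hy' : y ∈ D' := by
                  have e1 : ‖x‖ ≤ 1 := by simpa [A] using hx
                  have e2 : ‖y - x - t‖ ≤ 1 := by simpa [T, dist_eq_norm] using hy
                  rw [Metric.mem_closedBall, dist_eq_norm]
                  calc ‖y - t‖ = ‖(y - x - t) + x‖ := by congr 1; abel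
                    _ ≤ 2 := (norm_add_le _ _).trans (by linarith)
                simp [g, hx, hx', hy, hy']
              · simp [g, hy]
            · simp [g, hx]
          calc _ ≤ ∫⁻ x, ∫⁻ y, D.indicator (fun _ => 1) x * D'.indicator (fun _ => 1) y
                ∂(counting φ) ∂(counting φ) :=
                lintegral_mono fun x => lintegral_mono fun y => h6 x y
            _ = N D φ * N D' φ := by
                simp_rw [lintegral_const_mul _ (measurable_const.indicator hDm'),
                  lintegral_indicator_const hDm', one_mul]
                rw [lintegral_mul_const _ (measurable_const.indicator hDm),
                  lintegral_indicator_const hDm, one_mul,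
                  counting_apply_of_isBounded φ Metric.isBounded_closedBall hDm,
                  counting_apply_of_isBounded φ Metric.isBounded_closedBall hDm']
            _ ≤ _ := by
                norm_cast
                nlinarith [sq_nonneg ((N D φ : ℤ) - N D' φ), Nat.zero_le (N D φ * N D' φ),
                  two_mul_le_add_sq (N D φ) (N D' φ)]
      _ = S + S := by
          rw [lintegral_add_left (hmN Metric.isBounded_closedBall hDm), h4]
  rw [h1, h2] at h3
  calc intensity (palm B Q) T = (volume A)⁻¹ * (volume A * intensity (palm B Q) T) := by
        rw [← mul_assoc, ENNReal.inv_mul_cancel hA0 hA1, one_mul]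
    _ ≤ _ := by gcongr

end Campbell

/-! ### Lebesgue measure in the decomposition `E ⊕ F` -/

section Decomposition

variable {V : Type*} [NormedAddCommGroup V] [InnerProductSpace ℝ V] [FiniteDimensional ℝ V]
  [MeasurableSpace V] [BorelSpace V] {E F : Submodule ℝ V} (hEF : IsCompl E F)

theorem projectionOnto_add (u : E) (v : F) : E.projectionOnto F hEF ((u : V) + v) = u := by
  simp

theorem projectionOnto_symm_add (u : E) (v : F) :
    F.projectionOnto E hEF.symm ((u : V) + v) = v := by
  simp

/-- The volume of the sum of Borel sets of measure one in `E` and in `F`, which is the Jacobian of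
the sum map `E × F → V`. -/
noncomputable def sumVolume (CE : Set E) (CF : Set F) : ℝ≥0∞ :=
  volume (((↑) : E → V) '' CE + ((↑) : F → V) '' CF)

theorem volume_eq_smul_map (hEF : IsCompl E F) {CE : Set E} {CF : Set F}
    (hCE : volume CE = 1) (hCF : volume CF = 1)
    (hCEm : MeasurableSet CE) (hCFm : MeasurableSet CF) :
    sumVolume CE CF ≠ 0 ∧ sumVolume CE CF ≠ ∞ ∧ (volume : Measure V) = sumVolume CE CF •
      ((volume : Measure E).prod (volume : Measure F)).map fun p => (p.1 : V) + p.2 := by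
  let e : (E × F) ≃L[ℝ] V := (Submodule.prodEquivOfIsCompl E F hEF).toContinuousLinearEquiv
  have he : ∀ p : E × F, e p = (p.1 : V) + p.2 := fun p => rfl
  let M : Measure V := ((volume : Measure E).prod (volume : Measure F)).map e
  have hM : M.IsAddHaarMeasure := e.isAddHaarMeasure_map _
  have h1 := Measure.isAddLeftInvariant_eq_smul (volume : Measure V) M
  have h2 : ((↑) : E → V) '' CE + ((↑) : F → V) '' CF = e.symm ⁻¹' (CE ×ˢ CF) := by
    rw [← ContinuousLinearEquiv.image_eq_preimage_symm]
    ext x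
    simp only [Set.mem_add, mem_image, mem_prod, Prod.exists, he]
    constructor
    · rintro ⟨_, ⟨u, hu, rfl⟩, _, ⟨v, hv, rfl⟩, rfl⟩
      exact ⟨u, v, ⟨hu, hv⟩, rfl⟩
    · rintro ⟨u, v, ⟨hu, hv⟩, rfl⟩
      exact ⟨_, ⟨u, hu, rfl⟩, _, ⟨v, hv, rfl⟩, rfl⟩
  have h3 : M (((↑) : E → V) '' CE + ((↑) : F → V) '' CF) = 1 := by
    rw [h2, Measure.map_apply e.continuous.measurable
      (e.symm.continuous.measurable (hCEm.prod hCFm)), ← preimage_comp]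
    simp [Measure.prod_prod, hCE, hCF]
  set c := (volume : Measure V).addHaarScalarFactor M with hc
  have h4 : sumVolume CE CF = c := by
    rw [sumVolume, h1, Measure.smul_apply, h3]
    simp [ENNReal.smul_def]
  refine ⟨?_, ?_, ?_⟩
  · rw [h4, hc]
    exact_mod_cast (Measure.addHaarScalarFactor_pos_of_isAddHaarMeasure volume M).ne'
  · rw [h4]
    exact ENNReal.coe_ne_top
  · rw [h4]
    exact h1

variable {hEF} {α : ℝ≥0∞}

theorem lintegral_decomp (hvol : (volume : Measure V) = α •
      ((volume : Measure E).prod (volume : Measure F)).map fun p => (p.1 : V) + p.2)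
    {G : V → ℝ≥0∞} (hG : Measurable G) :
    ∫⁻ x, G x = α * ∫⁻ u : E, ∫⁻ v : F, G (u + v) := by
  have hm : Measurable fun p : E × F => (p.1 : V) + p.2 :=
    (measurable_subtype_coe.comp measurable_fst).add (measurable_subtype_coe.comp measurable_snd)
  have hm' : Measurable fun p : E × F => G ((p.1 : V) + p.2) := hG.comp hm
  rw [hvol, lintegral_smul_measure, lintegral_map hG hm, lintegral_prod _ hm'.aemeasurable,
    smul_eq_mul]

end Decomposition

/-! ### The autocorrelation of a window -/

section AutoConv

variable {V : Type*} [NormedAddCommGroup V] [InnerProductSpace ℝ V] [FiniteDimensional ℝ V]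
  [MeasurableSpace V] [BorelSpace V] {W : Set V}

theorem autoConv_eq (hWm : MeasurableSet W) (x : V) :
    autoConv W x = volume.real (W ∩ {w | x + w ∈ W}) := by
  have h1 : autoConv W x = volume.real (W ∩ {t | t - x ∈ W}) := by
    rw [autoConv, convolution, lebesgue_eq_volume, ← integral_indicator_one]
    · refine integral_congr_ae (Eventually.of_forall fun t => ?_)
      by_cases h1 : t ∈ W <;> by_cases h2 : t - x ∈ W <;> simp [indicator, h1, h2]
    · exact hWm.inter ((measurable_sub_const x) hWm)
  rw [h1, measureReal_def, measureReal_def, ← measure_preimage_add volume x]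
  congr 2
  ext w
  simp [and_comm]

theorem volume_inter_ne_top (hWb : IsBounded W) (S : Set V) : volume (W ∩ S) ≠ ∞ :=
  ((measure_mono inter_subset_left).trans_lt hWb.measure_lt_top).ne

theorem ofReal_autoConv (hWb : IsBounded W) (hWm : MeasurableSet W) (x : V) :
    ENNReal.ofReal (autoConv W x) = volume (W ∩ {w | x + w ∈ W}) := by
  rw [autoConv_eq hWm, ofReal_measureReal (volume_inter_ne_top hWb _)]

theorem autoConv_nonneg (hWm : MeasurableSet W) (x : V) : 0 ≤ autoConv W x := by
  rw [autoConv_eq hWm]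
  exact measureReal_nonneg

theorem autoConv_le (hWb : IsBounded W) (hWm : MeasurableSet W) (x : V) :
    autoConv W x ≤ volume.real W := by
  rw [autoConv_eq hWm]
  exact measureReal_mono inter_subset_left hWb.measure_lt_top.ne

theorem measurable_autoConv (hWm : MeasurableSet W) : Measurable (autoConv W) := by
  have hS : MeasurableSet {p : V × V | p.2 ∈ W ∧ p.1 + p.2 ∈ W} :=
    (measurable_snd hWm).inter ((measurable_fst.add measurable_snd) hWm)
  have h := (measurable_measure_prodMk_left (ν := (volume : Measure V)) hS).ennreal_toReal
  rwa [show autoConv W = fun x => _ from funext (autoConv_eq hWm)]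

theorem norm_le_of_autoConv_ne_zero (hWm : MeasurableSet W) {R : ℝ}
    (hR : W ⊆ Metric.closedBall 0 R) {x : V} (hx : autoConv W x ≠ 0) : ‖x‖ ≤ 2 * R := by
  by_contra hc
  refine hx ?_
  rw [autoConv_eq hWm]
  convert measureReal_empty
  refine eq_empty_of_forall_notMem fun w hw => hc ?_
  have h1 : ‖w‖ ≤ R := by simpa using hR hw.1
  have h2 : ‖x + w‖ ≤ R := by simpa using hR hw.2
  calc ‖x‖ = ‖(x + w) - w‖ := by rw [add_sub_cancel_right]
    _ ≤ 2 * R := (norm_sub_le _ _).trans (by linarith)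

end AutoConv

/-! ### The Palm measure of the projected process -/

section PalmCutProject

variable {V : Type*} [NormedAddCommGroup V] [InnerProductSpace ℝ V] [FiniteDimensional ℝ V]
  [MeasurableSpace V] [BorelSpace V] {E F : Submodule ℝ V} {hEF : IsCompl E F} {W : Set F}

theorem vadd_vadd_neg_eq (x : V) (φ : Config V) :
    ((F.projectionOnto E hEF.symm x : F) : V) +ᵥ (-x +ᵥ φ) =
      ((-(E.projectionOnto F hEF x) : E) : V) +ᵥ φ := by
  apply Subtype.ext
  simp only [vadd_val, vadd_vadd]
  congr 1
  have h := Submodule.projection_add_projection_eq_self hEF x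
  simp only [Submodule.projection_apply] at h
  rw [Submodule.coe_neg]
  nth_rw 2 [← h]
  abel

theorem measurable_coe_vadd : Measurable fun p : F × Config V => (p.1 : V) +ᵥ p.2 :=
  measurable_vadd_config.comp ((measurable_subtype_coe.comp measurable_fst).prodMk measurable_snd)

variable {Q : Measure (Config V)} [IsProbabilityMeasure Q] {B : Set V} {B' : Set E} {α : ℝ≥0∞}

/-- The refined Campbell formula for the points of `φ` in a slab: the points of `φ ∩ (B' × W)`,
seen from their own projections to `E`, are distributed according to the Palm measure. -/
theorem lintegral_lintegral_counting_slab (hWm : MeasurableSet W)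
    (hstat : VAddInvariantMeasure V (Config V) Q)
    (hsq : SquareIntegrable Q) (hB : MeasurableSet B) (hB0 : 0 < volume B) (hB1 : volume B < ∞)
    (hB' : MeasurableSet B') (hvol : (volume : Measure V) = α •
      ((volume : Measure E).prod (volume : Measure F)).map fun p => (p.1 : V) + p.2)
    {h : Config V → ℝ≥0∞} (hh : Measurable h) :
    ∫⁻ φ, ∫⁻ x, W.indicator (fun _ => 1) (F.projectionOnto E hEF.symm x) *
        (B'.indicator (fun _ => 1) (E.projectionOnto F hEF x) *
          h (((-(E.projectionOnto F hEF x) : E) : V) +ᵥ φ)) ∂(counting φ) ∂Q =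
      volume B' * (α * ∫⁻ w in W, ∫⁻ ψ, h ((w : V) +ᵥ ψ) ∂(palm B Q)) := by
  have := isFiniteMeasure_palm hstat hsq hB hB0 hB1
  have hgW : Measurable (W.indicator (fun _ => (1 : ℝ≥0∞))) := measurable_const.indicator hWm
  have hgB : Measurable (B'.indicator (fun _ => (1 : ℝ≥0∞))) := measurable_const.indicator hB'
  have hpE := measurable_projectionOnto hEF
  have hpF := measurable_projectionOnto hEF.symm
  have hH : Measurable fun p : V × Config V =>
      W.indicator (fun _ => (1 : ℝ≥0∞)) (F.projectionOnto E hEF.symm p.1) *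
        (B'.indicator (fun _ => 1) (E.projectionOnto F hEF p.1) *
          h (((F.projectionOnto E hEF.symm p.1 : F) : V) +ᵥ p.2)) :=
    (hgW.comp (hpF.comp measurable_fst)).mul ((hgB.comp (hpE.comp measurable_fst)).mul
      (hh.comp (measurable_coe_vadd.comp ((hpF.comp measurable_fst).prodMk measurable_snd))))
  have h1 := lintegral_lintegral_counting hstat hsq hB hB0 hB1 hH
  simp only [vadd_vadd_neg_eq (hEF := hEF)] at h1
  rw [h1, lintegral_decomp hvol hH.lintegral_prod_right']
  simp only [projectionOnto_add hEF, projectionOnto_symm_add hEF]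
  have hm : ∀ v : F, Measurable fun ψ : Config V => h ((v : V) +ᵥ ψ) := fun v =>
    hh.comp (measurable_coe_vadd.comp measurable_prodMk_left)
  have hm2 : Measurable fun v : F => ∫⁻ ψ, h ((v : V) +ᵥ ψ) ∂(palm B Q) :=
    (hh.comp measurable_coe_vadd).lintegral_prod_right'
  have h2 : ∀ (u : E) (v : F), ∫⁻ ψ, W.indicator (fun _ => (1 : ℝ≥0∞)) v *
      (B'.indicator (fun _ => 1) u * h ((v : V) +ᵥ ψ)) ∂(palm B Q) =
      B'.indicator (fun _ => 1) u * (W.indicator (fun _ => (1 : ℝ≥0∞)) v *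
        ∫⁻ ψ, h ((v : V) +ᵥ ψ) ∂(palm B Q)) := fun u v => by
    rw [lintegral_const_mul _ ((hm v).const_mul _), lintegral_const_mul _ (hm v),
      mul_left_comm]
  have h3 : ∀ u : E, ∫⁻ v : F, B'.indicator (fun _ => 1) u * (W.indicator (fun _ => (1 : ℝ≥0∞)) v *
        ∫⁻ ψ, h ((v : V) +ᵥ ψ) ∂(palm B Q)) =
      B'.indicator (fun _ => 1) u * ∫⁻ w in W, ∫⁻ ψ, h ((w : V) +ᵥ ψ) ∂(palm B Q) := fun u => by
    have hm3 : Measurable fun v : F => W.indicator (fun _ => (1 : ℝ≥0∞)) v *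
        ∫⁻ ψ, h ((v : V) +ᵥ ψ) ∂(palm B Q) := hgW.mul hm2
    rw [lintegral_const_mul _ hm3, ← lintegral_indicator hWm]
    congr 1
    refine lintegral_congr fun v => ?_
    by_cases hv : v ∈ W <;> simp [hv]
  simp_rw [h2, h3]
  rw [lintegral_mul_const _ hgB, lintegral_indicator_const hB', one_mul, mul_left_comm]

variable (hWb : IsBounded W)

theorem palm_map_cutProject_apply (hWm : MeasurableSet W)
    (hstat : VAddInvariantMeasure V (Config V) Q)
    (hsq : SquareIntegrable Q) (hB : MeasurableSet B) (hB0 : 0 < volume B) (hB1 : volume B < ∞)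
    (hB' : MeasurableSet B') (hB0' : 0 < volume B') (hB1' : volume B' < ∞)
    (hvol : (volume : Measure V) = α •
      ((volume : Measure E).prod (volume : Measure F)).map fun p => (p.1 : V) + p.2)
    (hinj : ∀ᵐ φ ∂Q, φ ∈ injConfigs hEF W)
    {𝒞 : Set (Config E)} (h𝒞 : MeasurableSet 𝒞) :
    palm B' (Q.map (cutProject hEF hWb)) 𝒞 = α * ∫⁻ w in W, ∫⁻ ψ,
      𝒞.indicator (fun _ => 1) (cutProject hEF hWb ((w : V) +ᵥ ψ)) ∂(palm B Q) := by
  have hc := measurable_cutProject hEF hWb hWm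
  have : IsProbabilityMeasure (Q.map (cutProject hEF hWb)) :=
    Measure.isProbabilityMeasure_map hc.aemeasurable
  have hg𝒞 : Measurable (𝒞.indicator (fun _ => (1 : ℝ≥0∞))) := measurable_const.indicator h𝒞
  have hm : Measurable fun q : Config E × E =>
      (B' ×ˢ 𝒞).indicator (fun _ => (1 : ℝ≥0∞)) (q.2, -q.2 +ᵥ q.1) :=
    (measurable_const.indicator (hB'.prod h𝒞)).comp measurable_snd_neg_vadd
  have hm1 : Measurable fun φ : Config E =>
      ∫⁻ y, (B' ×ˢ 𝒞).indicator (fun _ => (1 : ℝ≥0∞)) (y, -y +ᵥ φ) ∂(counting φ) :=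
    measurable_lintegral_counting measurable_id hm
  rw [palm_eq_campbell hB' h𝒞, campbell_prod hB' h𝒞, lintegral_map hm1 hc]
  have h1 : ∫⁻ φ, ∫⁻ y, (B' ×ˢ 𝒞).indicator (fun _ => (1 : ℝ≥0∞)) (y, -y +ᵥ cutProject hEF hWb φ)
        ∂(counting (cutProject hEF hWb φ)) ∂Q =
      ∫⁻ φ, ∫⁻ x, W.indicator (fun _ => 1) (F.projectionOnto E hEF.symm x) *
        (B'.indicator (fun _ => 1) (E.projectionOnto F hEF x) *
          𝒞.indicator (fun _ => 1) (cutProject hEF hWb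
            (((-(E.projectionOnto F hEF x) : E) : V) +ᵥ φ))) ∂(counting φ) ∂Q := by
    refine lintegral_congr_ae (hinj.mono fun φ hφ => ?_)
    have hm2 : Measurable fun y : E => (B' ×ˢ 𝒞).indicator (fun _ => (1 : ℝ≥0∞))
        (y, -y +ᵥ cutProject hEF hWb φ) := hm.comp measurable_prodMk_left
    simp only
    rw [lintegral_counting_cutProject hEF hWb hWm hφ hm2]
    refine lintegral_congr fun x => ?_
    rw [cutProject_vadd]
    congr 1
    by_cases h1 : E.projectionOnto F hEF x ∈ B' <;>
      by_cases h2 : -E.projectionOnto F hEF x +ᵥ cutProject hEF hWb φ ∈ 𝒞 <;>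
      simp [indicator, h1, h2]
  rw [h1, lintegral_lintegral_counting_slab hWm hstat hsq hB hB0 hB1 hB' hvol
    (h := fun φ => 𝒞.indicator (fun _ => 1) (cutProject hEF hWb φ)) (hg𝒞.comp hc),
    ← mul_assoc, ENNReal.inv_mul_cancel hB0'.ne' hB1'.ne, one_mul]

theorem measurable_cutProject_vadd (hWm : MeasurableSet W) :
    Measurable fun p : F × Config V => cutProject hEF hWb ((p.1 : V) +ᵥ p.2) :=
  (measurable_cutProject hEF hWb hWm).comp measurable_coe_vadd

theorem palm_map_cutProject (hWm : MeasurableSet W)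
    (hstat : VAddInvariantMeasure V (Config V) Q)
    (hsq : SquareIntegrable Q) (hB : MeasurableSet B) (hB0 : 0 < volume B) (hB1 : volume B < ∞)
    (hB' : MeasurableSet B') (hB0' : 0 < volume B') (hB1' : volume B' < ∞)
    (hvol : (volume : Measure V) = α •
      ((volume : Measure E).prod (volume : Measure F)).map fun p => (p.1 : V) + p.2)
    (hinj : ∀ᵐ φ ∂Q, φ ∈ injConfigs hEF W) :
    palm B' (Q.map (cutProject hEF hWb)) =
      Measure.map (fun p : F × Config V => cutProject hEF hWb ((p.1 : V) +ᵥ p.2))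
        (α • ((volume : Measure F).restrict W).prod (palm B Q)) := by
  have := isFiniteMeasure_palm hstat hsq hB hB0 hB1
  ext 𝒞 h𝒞
  have hf := measurable_cutProject_vadd (hEF := hEF) hWb hWm
  rw [palm_map_cutProject_apply hWb hWm hstat hsq hB hB0 hB1 hB' hB0' hB1' hvol hinj h𝒞,
    Measure.map_apply hf h𝒞, Measure.smul_apply, smul_eq_mul,
    ← lintegral_indicator_one (hf h𝒞),
    lintegral_prod _ (measurable_one.indicator (hf h𝒞)).aemeasurable]
  rfl

/-- Under `λ ⊗ Q̃` too, `p_E` is almost surely injective on the slab. -/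
theorem ae_vadd_mem_injConfigs (hWb : IsBounded W) (hWm : MeasurableSet W)
    (hstat : VAddInvariantMeasure V (Config V) Q)
    (hsq : SquareIntegrable Q) (hB : MeasurableSet B) (hB0 : 0 < volume B) (hB1 : volume B < ∞)
    (hα : α ≠ 0) (hvol : (volume : Measure V) = α •
      ((volume : Measure E).prod (volume : Measure F)).map fun p => (p.1 : V) + p.2)
    (hinj : ∀ᵐ φ ∂Q, φ ∈ injConfigs hEF W) :
    ∀ᵐ w : F ∂((volume : Measure F).restrict W),
      ∀ᵐ ψ ∂(palm B Q), (w : V) +ᵥ ψ ∈ injConfigs hEF W := by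
  have := isFiniteMeasure_palm hstat hsq hB hB0 hB1
  have hD := (measurableSet_injConfigs hEF hWb hWm).compl
  have hDi : Measurable ((injConfigs hEF W)ᶜ.indicator (fun _ => (1 : ℝ≥0∞))) :=
    measurable_const.indicator hD
  have h1 := lintegral_lintegral_counting_slab (hEF := hEF) (B' := univ) hWm hstat hsq hB hB0 hB1
    MeasurableSet.univ hvol hDi
  have h2 : ∫⁻ w in W, ∫⁻ ψ, (injConfigs hEF W)ᶜ.indicator (fun _ => (1 : ℝ≥0∞)) ((w : V) +ᵥ ψ)
      ∂(palm B Q) = 0 := by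
    have h3 : volume (univ : Set E) * (α * ∫⁻ w in W, ∫⁻ ψ,
        (injConfigs hEF W)ᶜ.indicator (fun _ => (1 : ℝ≥0∞)) ((w : V) +ᵥ ψ) ∂(palm B Q)) = 0 := by
      rw [← h1]
      refine (lintegral_congr_ae (hinj.mono fun φ hφ => ?_)).trans lintegral_zero
      refine (lintegral_congr fun x => ?_).trans lintegral_zero
      rw [indicator_of_notMem (s := (injConfigs hEF W)ᶜ) (not_not.2 (vadd_mem_injConfigs hEF _ hφ))]
      simp
    rcases mul_eq_zero.1 h3 with h4 | h4
    · exact absurd h4 (NeZero.ne _)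
    · exact (mul_eq_zero.1 h4).resolve_left hα
  have hm : Measurable fun p : F × Config V =>
      (injConfigs hEF W)ᶜ.indicator (fun _ => (1 : ℝ≥0∞)) ((p.1 : V) +ᵥ p.2) :=
    hDi.comp measurable_coe_vadd
  rw [lintegral_eq_zero_iff hm.lintegral_prod_right'] at h2
  refine h2.mono fun w hw => ?_
  have hw' := (lintegral_eq_zero_iff (hm.comp measurable_prodMk_left)).1 hw
  refine hw'.mono fun ψ hψ => ?_
  by_contra hc
  simp [indicator, hc] at hψ

/-- The intensity of the Palm measure of the projected process: integrating `1_W(w + x_F)` over the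
window `w ∈ W` gives the autocorrelation `ψ(x_F)`. -/
theorem intensity_palm_map_cutProject (hWm : MeasurableSet W)
    (hstat : VAddInvariantMeasure V (Config V) Q)
    (hsq : SquareIntegrable Q) (hB : MeasurableSet B) (hB0 : 0 < volume B) (hB1 : volume B < ∞)
    (hB' : MeasurableSet B') (hB0' : 0 < volume B') (hB1' : volume B' < ∞) (hα : α ≠ 0)
    (hvol : (volume : Measure V) = α •
      ((volume : Measure E).prod (volume : Measure F)).map fun p => (p.1 : V) + p.2)
    (hinj : ∀ᵐ φ ∂Q, φ ∈ injConfigs hEF W) {g : E → ℝ≥0∞} (hg : Measurable g) :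
    ∫⁻ y, g y ∂(intensity (palm B' (Q.map (cutProject hEF hWb)))) =
      α * ∫⁻ x, ENNReal.ofReal (autoConv W (F.projectionOnto E hEF.symm x)) *
        g (E.projectionOnto F hEF x) ∂(intensity (palm B Q)) := by
  have := isFiniteMeasure_palm hstat hsq hB hB0 hB1
  have hpE := measurable_projectionOnto hEF
  have hpF := measurable_projectionOnto hEF.symm
  have hgW : Measurable (W.indicator (fun _ => (1 : ℝ≥0∞))) := measurable_const.indicator hWm
  have hf := measurable_cutProject_vadd (hEF := hEF) hWb hWm
  have hm1 : Measurable fun φ : Config E => ∫⁻ y, g y ∂(counting φ) :=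
    measurable_lintegral_counting measurable_id (g := fun p => g p.2) (hg.comp measurable_snd)
  have hm3 : Measurable fun p : F × Config V =>
      ∫⁻ y, g y ∂(counting (cutProject hEF hWb ((p.1 : V) +ᵥ p.2))) := hm1.comp hf
  rw [lintegral_intensity hg,
    palm_map_cutProject hWb hWm hstat hsq hB hB0 hB1 hB' hB0' hB1' hvol hinj,
    lintegral_map hm1 hf, lintegral_smul_measure, smul_eq_mul,
    lintegral_prod _ hm3.aemeasurable]
  congr 1
  -- Summing over the points of `w + ψ` in the slab amounts to summing over those of `ψ`.
  let G : F × V → ℝ≥0∞ := fun p => W.indicator (fun _ => 1)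
    (p.1 + F.projectionOnto E hEF.symm p.2) * g (E.projectionOnto F hEF p.2)
  have hG : Measurable G := (hgW.comp (measurable_fst.add (hpF.comp measurable_snd))).mul
    (hg.comp (hpE.comp measurable_snd))
  have h1 : ∫⁻ w in W, ∫⁻ ψ, ∫⁻ y, g y ∂(counting (cutProject hEF hWb ((w : V) +ᵥ ψ))) ∂(palm B Q) =
      ∫⁻ w in W, ∫⁻ ψ, ∫⁻ x, G (w, x) ∂(counting ψ) ∂(palm B Q) := by
    refine lintegral_congr_ae ((ae_vadd_mem_injConfigs hWb hWm hstat hsq hB hB0 hB1 hα hvol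
      hinj).mono fun w hw => lintegral_congr_ae (hw.mono fun ψ hψ => ?_))
    have hm2 : Measurable fun x : V => W.indicator (fun _ => (1 : ℝ≥0∞))
        (F.projectionOnto E hEF.symm x) * g (E.projectionOnto F hEF x) :=
      (hgW.comp hpF).mul (hg.comp hpE)
    simp only
    rw [lintegral_counting_cutProject hEF hWb hWm hψ hg, lintegral_counting_vadd ψ _ hm2]
    refine lintegral_congr fun x => ?_
    simp only [G, map_add, Submodule.projectionOnto_apply_left,
      Submodule.projectionOnto_apply_right, zero_add]
  rw [h1]
  have h2 : ∀ w : F, ∫⁻ ψ, ∫⁻ x, G (w, x) ∂(counting ψ) ∂(palm B Q) =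
      ∫⁻ x, G (w, x) ∂(intensity (palm B Q)) := fun w =>
    (lintegral_intensity (g := fun x => G (w, x)) (hG.comp measurable_prodMk_left)).symm
  obtain ⟨C, hC⟩ := exists_intensity_palm_closedBall_le hstat hsq hB hB0 hB1
  have : SigmaFinite (intensity (palm B Q)) := by
    have : IsLocallyFiniteMeasure (intensity (palm B Q)) :=
      ⟨fun x => ⟨_, Metric.closedBall_mem_nhds x one_pos, (hC x).trans_lt ENNReal.coe_lt_top⟩⟩
    infer_instance
  simp_rw [h2]
  rw [lintegral_lintegral_swap hG.aemeasurable]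
  refine lintegral_congr fun x => ?_
  have hS : MeasurableSet {w : F | F.projectionOnto E hEF.symm x + w ∈ W} :=
    measurable_const_add _ hWm
  have h3 : ∀ w : F, G (w, x) = {w : F | F.projectionOnto E hEF.symm x + w ∈ W}.indicator
      (fun _ => (1 : ℝ≥0∞)) w * g (E.projectionOnto F hEF x) := fun w => by
    simp only [G, indicator, mem_ofPred_eq]
    rw [add_comm w]
  simp_rw [h3]
  rw [lintegral_mul_const _ (measurable_const.indicator hS), lintegral_indicator_const hS, one_mul,
    Measure.restrict_apply hS, ofReal_autoConv hWb hWm, inter_comm]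

end PalmCutProject

/-! ### Translation bounded measures -/

section TranslationBounded

variable {V : Type*} [NormedAddCommGroup V] [InnerProductSpace ℝ V] [FiniteDimensional ℝ V]
  [MeasurableSpace V] [BorelSpace V]

/-- A measure is translation bounded by `C` if each closed ball of radius one has measure at
most `C`. -/
def TranslationBounded (μ : Measure V) (C : NNReal) : Prop :=
  ∀ t : V, μ (Metric.closedBall t 1) ≤ C

theorem TranslationBounded.isLocallyFiniteMeasure {μ : Measure V} {C : NNReal}
    (h : TranslationBounded μ C) : IsLocallyFiniteMeasure μ :=
  ⟨fun x => ⟨_, Metric.closedBall_mem_nhds x one_pos, (h x).trans_lt ENNReal.coe_lt_top⟩⟩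

/-- The weight `(1 + ‖x‖)⁻ᵖ`. -/
noncomputable def weight (p : ℕ) (x : V) : ℝ := (1 + ‖x‖) ^ (-(p : ℝ))

theorem weight_pos (p : ℕ) (x : V) : 0 < weight p x := Real.rpow_pos_of_pos (by positivity) _

theorem continuous_weight (p : ℕ) : Continuous (weight p : V → ℝ) :=
  Continuous.rpow_const (by fun_prop) fun x => Or.inl (by positivity)

theorem weight_mul_pow (p : ℕ) (x : V) : weight p x * (1 + ‖x‖) ^ p = 1 := by
  rw [weight, Real.rpow_neg (by positivity), Real.rpow_natCast]
  exact inv_mul_cancel₀ (by positivity)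

theorem measurable_ofReal_weight (p : ℕ) :
    Measurable fun x : V => ENNReal.ofReal (weight p x) :=
  (continuous_weight p).measurable.ennreal_ofReal

/-- Translation bounded measures integrate `(1 + ‖x‖)^{-(d + 1)}`, with a bound depending on
nothing but the bound of the measure: compare the weight with its averages over unit balls. -/
theorem exists_lintegral_weight_le (V : Type*) [NormedAddCommGroup V] [InnerProductSpace ℝ V]
    [FiniteDimensional ℝ V] [MeasurableSpace V] [BorelSpace V] :
    ∃ K : NNReal, ∀ (μ : Measure V) (C : NNReal), TranslationBounded μ C →
      ∫⁻ x, ENNReal.ofReal (weight (Module.finrank ℝ V + 1) x) ∂μ ≤ C * K := by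
  set p := Module.finrank ℝ V + 1 with hp
  set J : ℝ≥0∞ := ∫⁻ x : V, ENNReal.ofReal (weight p x) with hJ
  have hJt : J < ∞ := finite_integral_one_add_norm (by rw [hp]; push_cast; linarith)
  set v : ℝ≥0∞ := volume (Metric.closedBall (0 : V) 1) with hv
  have hv0 : v ≠ 0 := (Metric.measure_closedBall_pos volume _ one_pos).ne'
  have hv1 : v ≠ ∞ := (isCompact_closedBall (0 : V) 1).measure_lt_top.ne
  have hK : v⁻¹ * (2 ^ p * J) ≠ ∞ := ENNReal.mul_ne_top (ENNReal.inv_ne_top.2 hv0)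
    (ENNReal.mul_ne_top (by simp) hJt.ne)
  refine ⟨(v⁻¹ * (2 ^ p * J)).toNNReal, fun μ C hμ => ?_⟩
  rw [ENNReal.coe_toNNReal hK]
  have := hμ.isLocallyFiniteMeasure
  have h1 : ∀ x y : V, y ∈ Metric.closedBall x 1 →
      ENNReal.ofReal (weight p x) ≤ 2 ^ p * ENNReal.ofReal (weight p y) := by
    intro x y hxy
    have h2 : ‖y‖ ≤ ‖x‖ + 1 := by
      have h := norm_sub_le_of_le (le_refl ‖x‖) (le_refl ‖x - y‖)
      rw [sub_sub_cancel] at h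
      have h' : ‖x - y‖ ≤ 1 := by simpa [dist_eq_norm, norm_sub_rev] using hxy
      linarith
    have h3 : weight p x ≤ 2 ^ p * weight p y := by
      have e1 := weight_mul_pow p x
      have e2 := weight_mul_pow p y
      have e3 : (1 + ‖y‖) ^ p ≤ 2 ^ p * (1 + ‖x‖) ^ p := by
        rw [← mul_pow]
        gcongr
        linarith [norm_nonneg x]
      have hx := weight_pos p x
      have hy := weight_pos p y
      calc weight p x = weight p x * (weight p y * (1 + ‖y‖) ^ p) := by rw [e2, mul_one]
        _ ≤ weight p x * (weight p y * (2 ^ p * (1 + ‖x‖) ^ p)) := by gcongr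
        _ = 2 ^ p * weight p y * (weight p x * (1 + ‖x‖) ^ p) := by ring
        _ = _ := by rw [e1, mul_one]
    calc ENNReal.ofReal (weight p x) ≤ ENNReal.ofReal (2 ^ p * weight p y) :=
          ENNReal.ofReal_le_ofReal h3
      _ = _ := by
          rw [ENNReal.ofReal_mul (by positivity), ENNReal.ofReal_pow (by norm_num)]
          norm_num
  let D : Set (V × V) := {q | dist q.2 q.1 ≤ 1}
  have hD : MeasurableSet D :=
    (isClosed_le (continuous_snd.dist continuous_fst) continuous_const).measurableSet
  let H : V × V → ℝ≥0∞ := fun q => D.indicator (fun _ => 1) q *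
    (2 ^ p * ENNReal.ofReal (weight p q.2))
  have hH : Measurable H := (measurable_const.indicator hD).mul
    (((measurable_ofReal_weight p).comp measurable_snd).const_mul _)
  have h4 : ∀ x : V, v * ENNReal.ofReal (weight p x) ≤ ∫⁻ y, H (x, y) := by
    intro x
    have h5 : v = volume (Metric.closedBall x 1) := by
      rw [hv, Measure.addHaar_closedBall_center volume x]
    calc v * ENNReal.ofReal (weight p x)
        = ∫⁻ y, (Metric.closedBall x 1).indicator (fun _ => ENNReal.ofReal (weight p x)) y := by
          rw [lintegral_indicator_const Metric.isClosed_closedBall.measurableSet, ← h5, mul_comm]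
      _ ≤ ∫⁻ y, H (x, y) := by
          refine lintegral_mono fun y => ?_
          by_cases hy : y ∈ Metric.closedBall x 1
          · have hy' : (x, y) ∈ D := hy
            simpa [H, hy, hy'] using h1 x y hy
          · simp [hy]
  have h6 : ∀ y : V, ∫⁻ x, H (x, y) ∂μ ≤ C * (2 ^ p * ENNReal.ofReal (weight p y)) := by
    intro y
    have h7 : ∀ x, D.indicator (fun _ => (1 : ℝ≥0∞)) (x, y) =
        (Metric.closedBall y 1).indicator (fun _ => 1) x := fun x => by
      simp [indicator, D, dist_comm]
    simp only [H, h7]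
    rw [lintegral_mul_const _ (measurable_const.indicator Metric.isClosed_closedBall.measurableSet),
      lintegral_indicator_const Metric.isClosed_closedBall.measurableSet, one_mul]
    gcongr
    exact hμ y
  have h8 : v * ∫⁻ x, ENNReal.ofReal (weight p x) ∂μ ≤ C * (2 ^ p * J) := by
    calc _ = ∫⁻ x, v * ENNReal.ofReal (weight p x) ∂μ :=
          (lintegral_const_mul _ (measurable_ofReal_weight p)).symm
      _ ≤ ∫⁻ x, (∫⁻ y, H (x, y)) ∂μ := lintegral_mono h4
      _ = ∫⁻ y, ∫⁻ x, H (x, y) ∂μ := lintegral_lintegral_swap hH.aemeasurable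
      _ ≤ ∫⁻ y, C * (2 ^ p * ENNReal.ofReal (weight p y)) := lintegral_mono h6
      _ = _ := by
          rw [lintegral_const_mul _ ((measurable_ofReal_weight p).const_mul _),
            lintegral_const_mul _ (measurable_ofReal_weight p)]
  calc ∫⁻ x, ENNReal.ofReal (weight p x) ∂μ = v⁻¹ * (v * ∫⁻ x, ENNReal.ofReal (weight p x) ∂μ) := by
        rw [← mul_assoc, ENNReal.inv_mul_cancel hv0 hv1, one_mul]
    _ ≤ v⁻¹ * (C * (2 ^ p * J)) := by gcongr
    _ = _ := by ring

theorem hasTemperateGrowth_of_lintegral_weight {μ : Measure V} (p : ℕ)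
    (h : ∫⁻ x, ENNReal.ofReal (weight p x) ∂μ < ∞) : μ.HasTemperateGrowth := by
  refine ⟨p, ⟨(continuous_weight p).aestronglyMeasurable, ?_⟩⟩
  exact (hasFiniteIntegral_iff_ofReal (f := weight p)
    (Eventually.of_forall fun x => (weight_pos p x).le)).2 h

theorem TranslationBounded.hasTemperateGrowth {μ : Measure V} {C : NNReal}
    (h : TranslationBounded μ C) : μ.HasTemperateGrowth := by
  obtain ⟨K, hK⟩ := exists_lintegral_weight_le V
  exact hasTemperateGrowth_of_lintegral_weight _
    ((hK μ C h).trans_lt (ENNReal.mul_lt_top ENNReal.coe_lt_top ENNReal.coe_lt_top))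

/-- A Schwartz function times a power of `1 + ‖x‖`, as a bounded continuous function. -/
noncomputable def powMulSchwartz (p : ℕ) (g : 𝓢(V, ℂ)) : BoundedContinuousFunction V ℂ :=
  BoundedContinuousFunction.ofNormedAddCommGroup (fun x => ((1 + ‖x‖) ^ p : ℝ) • g x)
    (by fun_prop) (2 ^ p * ((Finset.Iic (p, 0)).sup fun m => SchwartzMap.seminorm ℝ m.1 m.2) g)
    (fun x => by
      have h := SchwartzMap.one_add_le_sup_seminorm_apply (𝕜 := ℝ) (m := (p, 0)) (k := p) (n := 0)
        le_rfl le_rfl g x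
      rw [norm_iteratedFDeriv_zero] at h
      rwa [norm_smul, Real.norm_of_nonneg (by positivity)])

/-- Uniformly translation bounded measures are relatively compact in the sense of tempered
distributions: with the weight `(1 + ‖x‖)^{-(d + 2)}` they become tight and bounded, so that
Prokhorov's theorem applies. -/
theorem exists_limit_of_translationBounded {ν : ℕ → Measure V} {D : NNReal}
    (hν : ∀ n, TranslationBounded (ν n) D) :
    ∃ ν' : Measure V, ν'.HasTemperateGrowth ∧ ∀ g : 𝓢(V, ℂ),
      Tendsto (fun n => ∫ x, g x ∂(ν n)) (hyperfilter ℕ) (𝓝 (∫ x, g x ∂ν')) := by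
  obtain ⟨K, hK⟩ := exists_lintegral_weight_le V
  set p := Module.finrank ℝ V + 1 with hp
  have hw1 : ∀ x : V, weight (p + 1) x = weight p x * (1 + ‖x‖)⁻¹ := by
    intro x
    have hx : (0 : ℝ) < 1 + ‖x‖ := by positivity
    rw [weight, weight, ← Real.rpow_neg_one, ← Real.rpow_add hx]
    congr 1
    push_cast
    ring
  let ρ : ℕ → Measure V := fun n => (ν n).withDensity fun x => ENNReal.ofReal (weight (p + 1) x)
  have htail : ∀ n j : ℕ, ρ n (Metric.closedBall 0 (j : ℝ))ᶜ ≤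
      ((D * K / (1 + j) : NNReal) : ℝ≥0∞) := by
    intro n j
    have hm : MeasurableSet (Metric.closedBall (0 : V) (j : ℝ))ᶜ :=
      Metric.isClosed_closedBall.measurableSet.compl
    have hj : (0 : ℝ) < 1 + j := by positivity
    rw [withDensity_apply _ hm]
    calc ∫⁻ x in (Metric.closedBall (0 : V) (j : ℝ))ᶜ, ENNReal.ofReal (weight (p + 1) x) ∂(ν n)
        ≤ ∫⁻ x in (Metric.closedBall (0 : V) (j : ℝ))ᶜ,
            ENNReal.ofReal ((1 + j : ℝ)⁻¹) * ENNReal.ofReal (weight p x) ∂(ν n) := by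
          refine setLIntegral_mono' hm fun x hx => ?_
          rw [← ENNReal.ofReal_mul (by positivity), hw1, mul_comm]
          have hx' : (j : ℝ) < ‖x‖ := by simpa using hx
          have := weight_pos p x
          gcongr
      _ ≤ ∫⁻ x, ENNReal.ofReal ((1 + j : ℝ)⁻¹) * ENNReal.ofReal (weight p x) ∂(ν n) :=
          setLIntegral_le_lintegral _ _
      _ ≤ ENNReal.ofReal ((1 + j : ℝ)⁻¹) * (D * K) := by
          rw [lintegral_const_mul _ (measurable_ofReal_weight p)]
          gcongr
          exact hK _ _ (hν n)
      _ = _ := by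
          rw [show (1 + j : ℝ)⁻¹ = (((1 + j : NNReal)⁻¹ : NNReal) : ℝ) by push_cast; rfl,
            ENNReal.ofReal_coe_nnreal, ← ENNReal.coe_mul, ← ENNReal.coe_mul, div_eq_mul_inv,
            mul_comm]
  have hmass : ∀ n, ρ n univ ≤ ((D * K : NNReal) : ℝ≥0∞) := by
    intro n
    rw [withDensity_apply _ MeasurableSet.univ, Measure.restrict_univ, ENNReal.coe_mul]
    refine (lintegral_mono fun x => ENNReal.ofReal_le_ofReal ?_).trans (hK _ _ (hν n))
    rw [hw1]
    exact mul_le_of_le_one_right (weight_pos p x).le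
      (inv_le_one_of_one_le₀ (by linarith [norm_nonneg x]))
  have hfin : ∀ n, IsFiniteMeasure (ρ n) := fun n => ⟨(hmass n).trans_lt ENNReal.coe_lt_top⟩
  let ρ' : ℕ → FiniteMeasure V := fun n => ⟨ρ n, hfin n⟩
  have hu : Tendsto (fun j : ℕ => D * K / (1 + j : NNReal)) atTop (𝓝 0) := by
    simpa using tendsto_const_div_atTop_nhds_zero_nat (D * K : NNReal) |>.comp
      (tendsto_add_atTop_nat 1) |>.congr fun j => by simp [add_comm]
  have hcomp := isCompact_setOfPred_finiteMeasure_mass_le_compl_isCompact_le (E := V) (D * K) hu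
    (K := fun j : ℕ => Metric.closedBall (0 : V) (j : ℝ)) (fun j => isCompact_closedBall _ _)
    (Or.inl inferInstance)
  obtain ⟨ρ₀, -, hρ₀⟩ := hcomp.ultrafilter_le_nhds' ((hyperfilter ℕ).map ρ') (by
    refine Filter.Eventually.of_forall (f := (hyperfilter ℕ : Filter ℕ)) fun n => ⟨?_, fun j => ?_⟩
    · have := hmass n
      rw [← ENNReal.coe_le_coe, FiniteMeasure.ennreal_mass]
      exact this
    · rw [← ENNReal.coe_le_coe, FiniteMeasure.ennreal_coeFn_eq_coeFn_toMeasure]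
      exact htail n j)
  have hρt : Tendsto ρ' (hyperfilter ℕ) (𝓝 ρ₀) := hρ₀
  have hpm : Measurable fun x : V => ENNReal.ofReal ((1 + ‖x‖) ^ (p + 1)) :=
    (Continuous.measurable (by fun_prop)).ennreal_ofReal
  refine ⟨(ρ₀ : Measure V).withDensity fun x => ENNReal.ofReal ((1 + ‖x‖) ^ (p + 1)), ?_, ?_⟩
  · refine hasTemperateGrowth_of_lintegral_weight (p + 1) ?_
    rw [lintegral_withDensity_eq_lintegral_mul _ hpm (measurable_ofReal_weight _)]
    have h1 : ((fun x : V => ENNReal.ofReal ((1 + ‖x‖) ^ (p + 1))) *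
        fun x => ENNReal.ofReal (weight (p + 1) x)) = fun _ => 1 := by
      ext1 x
      rw [Pi.mul_apply, ← ENNReal.ofReal_mul (by positivity), mul_comm, weight_mul_pow,
        ENNReal.ofReal_one]
    rw [h1, lintegral_one]
    exact measure_lt_top _ _
  · intro g
    have h2 := (FiniteMeasure.tendsto_iff_forall_integral_rclike_tendsto ℂ).1 hρt
      (powMulSchwartz (p + 1) g)
    convert h2 using 2 with n
    · change _ = ∫ x, ((1 + ‖x‖) ^ (p + 1) : ℝ) • g x ∂(ρ n)
      rw [integral_withDensity_eq_integral_toReal_smul (measurable_ofReal_weight _)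
        (Eventually.of_forall fun x => ENNReal.ofReal_lt_top)]
      refine integral_congr_ae (Eventually.of_forall fun x => ?_)
      simp only
      rw [ENNReal.toReal_ofReal (weight_pos _ x).le, smul_smul, weight_mul_pow, one_smul]
    · rw [integral_withDensity_eq_integral_toReal_smul hpm
        (Eventually.of_forall fun x => ENNReal.ofReal_lt_top)]
      refine integral_congr_ae (Eventually.of_forall fun x => ?_)
      simp only
      rw [ENNReal.toReal_ofReal (by positivity)]
      rfl

end TranslationBounded

/-! ### Bump functions -/

section Bump

variable {V : Type*} [NormedAddCommGroup V] [InnerProductSpace ℝ V] [FiniteDimensional ℝ V]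
  [MeasurableSpace V] [BorelSpace V]

/-- A smooth function with values in `[0, 1]`, equal to one on `closedBall 0 r` and supported in
`closedBall 0 (2 * r)`. -/
noncomputable def ballBump (V : Type*) [NormedAddCommGroup V] [InnerProductSpace ℝ V]
    [FiniteDimensional ℝ V] (r : ℝ) (hr : 0 < r) : ContDiffBump (0 : V) :=
  ⟨r, 2 * r, hr, by linarith⟩

/-- The translate of `ballBump` centred at `t`, as a complex Schwartz function. -/
noncomputable def bumpAt (r : ℝ) (hr : 0 < r) (t : V) : 𝓢(V, ℂ) :=
  HasCompactSupport.toSchwartzMap (f := fun x : V => ((ballBump V r hr (x - t) : ℝ) : ℂ))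
    (((ballBump V r hr).hasCompactSupport.comp_homeomorph (Homeomorph.subRight t)).comp_left
      Complex.ofReal_zero)
    (Complex.ofRealCLM.contDiff.comp ((ballBump V r hr).contDiff.comp
      (contDiff_id.sub contDiff_const)))

theorem bumpAt_apply (r : ℝ) (hr : 0 < r) (t x : V) :
    bumpAt r hr t x = ((ballBump V r hr (x - t) : ℝ) : ℂ) := rfl

theorem ballBump_eq_one {r : ℝ} (hr : 0 < r) {t x : V} (hx : x ∈ Metric.closedBall t r) :
    ballBump V r hr (x - t) = 1 := by
  refine (ballBump V r hr).one_of_mem_closedBall ?_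
  simpa [ballBump, dist_eq_norm] using hx

theorem norm_fourier_bumpAt (r : ℝ) (hr : 0 < r) (t ξ : V) :
    ‖𝓕 (bumpAt r hr t) ξ‖ = ‖𝓕 (bumpAt r hr (0 : V)) ξ‖ := by
  rw [SchwartzMap.fourier_coe, SchwartzMap.fourier_coe, Real.fourier_eq, Real.fourier_eq]
  have h1 : ∫ x, Real.fourierChar (-inner ℝ x ξ) • bumpAt r hr t x =
      Real.fourierChar (-inner ℝ t ξ) • ∫ x, Real.fourierChar (-inner ℝ x ξ) •
        bumpAt r hr (0 : V) x := by
    rw [← integral_add_right_eq_self _ t, Circle.smul_def, ← integral_smul]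
    refine integral_congr_ae (Eventually.of_forall fun x => ?_)
    simp only [bumpAt_apply, add_sub_cancel_right, sub_zero, inner_add_left, neg_add,
      AddChar.map_add_eq_mul, Circle.smul_def, smul_smul, Circle.coe_mul]
    rw [mul_comm]
  rw [h1, Circle.norm_smul]

end Bump

/-! ### The Fourier transform of the intensity of the Palm measure -/

section PositiveDefinite

variable {V : Type*} [NormedAddCommGroup V] [InnerProductSpace ℝ V] [FiniteDimensional ℝ V]
  [MeasurableSpace V] [BorelSpace V]

/-- A Bochner–Schwartz theorem for translation bounded measures: if the measures `k n • μ` are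
finite with nonnegative Fourier transforms and `k n → 1` boundedly, then `μ` has a Fourier
transform that is a positive measure. -/
theorem exists_isFourierTransform {μ : Measure V} {C : NNReal} (hμ : TranslationBounded μ C)
    {k : ℕ → V → ℝ} (hk0 : ∀ n x, 0 ≤ k n x) (hk1 : ∀ n x, k n x ≤ 1)
    (hkm : ∀ n, Measurable (k n)) (hki : ∀ n, Integrable (k n) μ)
    (hkt : ∀ x, Tendsto (fun n => k n x) atTop (𝓝 1))
    (hpos : ∀ n t, ∃ s : ℝ, 0 ≤ s ∧
      ∫ z, Real.fourierChar (-inner ℝ z t) • ((k n z : ℝ) : ℂ) ∂μ = s) :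
    ∃ ν : Measure V, IsFourierTransform μ ν := by
  have hμl := hμ.isLocallyFiniteMeasure
  have hμt := hμ.hasTemperateGrowth
  choose S hS0 hS using hpos
  have hki' : ∀ n, Integrable (fun z => ((k n z : ℝ) : ℂ)) μ := fun n => (hki n).ofReal
  have hL : Continuous fun p : V × V => innerₗ V p.1 p.2 := continuous_inner
  have hSc : ∀ n, Continuous (S n) := fun n => by
    have h1 := VectorFourier.fourierIntegral_continuous Real.continuous_fourierChar hL (hki' n)
    have h2 : S n = fun t => (VectorFourier.fourierIntegral Real.fourierChar μ (innerₗ V)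
        (fun z => ((k n z : ℝ) : ℂ)) t).re := funext fun t => by
      rw [VectorFourier.fourierIntegral]
      change _ = (∫ z, Real.fourierChar (-inner ℝ z t) • ((k n z : ℝ) : ℂ) ∂μ).re
      rw [hS, Complex.ofReal_re]
    rw [h2]
    exact Complex.continuous_re.comp h1
  have hSm : ∀ n, Measurable fun t => ENNReal.ofReal (S n t) := fun n =>
    (hSc n).measurable.ennreal_ofReal
  let ν : ℕ → Measure V := fun n => volume.withDensity fun t => ENNReal.ofReal (S n t)
  have hνi : ∀ n (g : V → ℂ), ∫ t, g t ∂(ν n) = ∫ t, (S n t : ℂ) * g t := fun n g => by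
    rw [integral_withDensity_eq_integral_toReal_smul (hSm n)
      (Eventually.of_forall fun x => ENNReal.ofReal_lt_top)]
    refine integral_congr_ae (Eventually.of_forall fun t => ?_)
    simp only
    rw [ENNReal.toReal_ofReal (hS0 n t), Complex.real_smul]
  have hfub : ∀ n (g : 𝓢(V, ℂ)), ∫ t, g t ∂(ν n) = ∫ z, (k n z : ℂ) * 𝓕 g z ∂μ := fun n g => by
    have h1 := VectorFourier.integral_fourierIntegral_smul_eq_flip (μ := μ)
      (ν := (volume : Measure V)) (L := innerₗ V) Real.continuous_fourierChar hL (hki' n)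
      g.integrable
    rw [hνi]
    calc ∫ t, (S n t : ℂ) * g t = ∫ t, VectorFourier.fourierIntegral Real.fourierChar μ (innerₗ V)
          (fun z => ((k n z : ℝ) : ℂ)) t • g t :=
          integral_congr_ae (Eventually.of_forall fun t => by
            simp only [VectorFourier.fourierIntegral, innerₗ_apply_apply, hS, smul_eq_mul])
      _ = _ := h1
      _ = _ := by
          refine integral_congr_ae (Eventually.of_forall fun z => ?_)
          simp only
          rw [flip_innerₗ, SchwartzMap.fourier_coe]
          rfl
  -- The densities are uniformly translation bounded: test them against translated bumps.
  let G : V → 𝓢(V, ℂ) := bumpAt 1 one_pos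
  set D : ℝ := ∫ z, ‖𝓕 (G 0) z‖ ∂μ with hD
  have hνb : ∀ n, TranslationBounded (ν n) D.toNNReal := fun n t => by
    let b : V → ℝ := fun x => ballBump V 1 one_pos (x - t)
    have hb0 : ∀ x, 0 ≤ b x := fun x => (ballBump V 1 one_pos).nonneg
    have hbc : Continuous b := (ballBump V 1 one_pos).continuous.comp (continuous_sub_right t)
    have hbs : HasCompactSupport b :=
      (ballBump V 1 one_pos).hasCompactSupport.comp_homeomorph (Homeomorph.subRight t)
    have hbi : Integrable (fun x => S n x * b x) :=
      ((hSc n).mul hbc).integrable_of_hasCompactSupport hbs.mul_left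
    have h1 : ((∫ x, S n x * b x : ℝ) : ℂ) = ∫ z, (k n z : ℂ) * 𝓕 (G t) z ∂μ := by
      rw [← hfub, hνi, ← integral_complex_ofReal]
      refine integral_congr_ae (Eventually.of_forall fun x => ?_)
      simp only [Complex.ofReal_mul]
      rfl
    have h2 : ∫ x, S n x * b x ≤ D := by
      calc ∫ x, S n x * b x ≤ ‖((∫ x, S n x * b x : ℝ) : ℂ)‖ := by
            rw [Complex.norm_real]
            exact Real.le_norm_self _
        _ ≤ ∫ z, ‖𝓕 (G 0) z‖ ∂μ := by
            rw [h1]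
            refine norm_integral_le_of_norm_le (SchwartzMap.integrable (𝓕 (G 0))).norm
              (Eventually.of_forall fun z => ?_)
            rw [norm_mul, Complex.norm_real, Real.norm_of_nonneg (hk0 n z), norm_fourier_bumpAt]
            exact mul_le_of_le_one_left (norm_nonneg _) (hk1 n z)
    calc ν n (Metric.closedBall t 1)
        = ∫⁻ x in Metric.closedBall t 1, ENNReal.ofReal (S n x) :=
          withDensity_apply _ Metric.isClosed_closedBall.measurableSet
      _ ≤ ∫⁻ x in Metric.closedBall t 1, ENNReal.ofReal (S n x * b x) := by
          refine setLIntegral_mono' Metric.isClosed_closedBall.measurableSet fun x hx => ?_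
          rw [show b x = 1 from ballBump_eq_one one_pos hx, mul_one]
      _ ≤ ∫⁻ x, ENNReal.ofReal (S n x * b x) := setLIntegral_le_lintegral _ _
      _ = ENNReal.ofReal (∫ x, S n x * b x) :=
          (ofReal_integral_eq_lintegral_ofReal hbi
            (Eventually.of_forall fun x => mul_nonneg (hS0 n x) (hb0 x))).symm
      _ ≤ _ := ENNReal.ofReal_le_ofReal h2
  -- On the Fourier side the densities converge along an ultrafilter, on the other side `k n → 1`.
  obtain ⟨ν', hν', hlim⟩ := exists_limit_of_translationBounded hνb
  refine ⟨ν', hμt, hν', ?_⟩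
  ext g
  change ∫ z, 𝓕 g z ∂μ = ∫ t, g t ∂ν'
  have h3 : Tendsto (fun n => ∫ t, g t ∂(ν n)) atTop (𝓝 (∫ z, 𝓕 g z ∂μ)) := by
    simp_rw [hfub]
    refine tendsto_integral_of_dominated_convergence (fun z => ‖𝓕 g z‖) (fun n => ?_)
      (SchwartzMap.integrable (𝓕 g)).norm (fun n => Eventually.of_forall fun z => ?_)
      (Eventually.of_forall fun z => ?_)
    · exact (Complex.measurable_ofReal.comp (hkm n)).aestronglyMeasurable.mul
        (𝓕 g).continuous.aestronglyMeasurable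
    · rw [norm_mul, Complex.norm_real, Real.norm_of_nonneg (hk0 n z)]
      exact mul_le_of_le_one_left (norm_nonneg _) (hk1 n z)
    · have h := ((Complex.continuous_ofReal.tendsto _).comp (hkt z)).mul_const (𝓕 g z)
      simpa using h
  exact tendsto_nhds_unique (h3.mono_left (Nat.hyperfilter_le_atTop)) (hlim g)

variable {Q : Measure (Config V)} [IsProbabilityMeasure Q] {B : Set V}

/-- The intensity of the Palm measure is positive definite: the Fourier transform of its product
with `1_A * 1_{-A}` at `t` is `E |∑_{x ∈ φ ∩ A} exp(2πi⟪x, t⟫)|²`. -/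
theorem integral_fourierChar_autoConv (hstat : VAddInvariantMeasure V (Config V) Q)
    (hsq : SquareIntegrable Q) (hB : MeasurableSet B) (hB0 : 0 < volume B) (hB1 : volume B < ∞)
    {A : Set V} (hA : IsBounded A) (hAm : MeasurableSet A) (t : V) :
    ∫ z, Real.fourierChar (-inner ℝ z t) • ((autoConv A z : ℝ) : ℂ) ∂(intensity (palm B Q)) =
      ((∫ φ, ‖∫ x, A.indicator (fun x => (Real.fourierChar (inner ℝ x t) : ℂ)) x
        ∂(counting φ)‖ ^ 2 ∂Q : ℝ) : ℂ) := by
  obtain ⟨C, hC⟩ := exists_intensity_palm_closedBall_le hstat hsq hB hB0 hB1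
  have hlf : IsLocallyFiniteMeasure (intensity (palm B Q)) :=
    TranslationBounded.isLocallyFiniteMeasure hC
  set I := intensity (palm B Q) with hI
  let T : Config V × (V × V) → V × V := fun p => (p.2.1, p.2.2 - p.2.1)
  have hT : Measurable T :=
    measurable_snd.fst.prodMk (measurable_snd.snd.sub measurable_snd.fst)
  have hM : (Q ⊗ₘ ((countingKernel V) ×ₖ (countingKernel V))).map T = volume.prod I := by
    refine Measure.ext_of_lintegral _ fun f hf => ?_
    have hfT : Measurable fun q : V × V => f (q.1, q.2 - q.1) :=
      hf.comp (measurable_fst.prodMk (measurable_snd.sub measurable_fst))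
    have hfT' : Measurable fun p => f (T p) := hf.comp hT
    rw [lintegral_map hf hT, Measure.lintegral_compProd hfT', lintegral_prod _ hf.aemeasurable]
    have h1 := lintegral_second_moment hstat hsq hB hB0 hB1 hfT
    simp only [add_sub_cancel_left] at h1
    rw [hI, ← h1]
    refine lintegral_congr fun φ => ?_
    rw [Kernel.prod_apply, countingKernel_apply]
    exact lintegral_prod _ hfT.aemeasurable
  let e : V → ℂ := fun x => (Real.fourierChar (inner ℝ x t) : ℂ)
  have he : Continuous e := by fun_prop
  have hecj : ∀ x, (Real.fourierChar (-inner ℝ x t) : ℂ) = starRingEnd ℂ (e x) := fun x => by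
    simp only [e]
    rw [AddChar.map_neg_eq_inv, Circle.coe_inv_eq_conj]
  have he1 : ∀ x, ‖e x‖ = 1 := fun x => Circle.norm_coe _
  let h : V × V → ℂ := fun p => A.indicator (fun _ => 1) p.1 *
    A.indicator (fun _ => 1) (p.1 + p.2) * starRingEnd ℂ (e p.2)
  have hAi : Measurable (A.indicator (fun _ => (1 : ℂ))) := measurable_const.indicator hAm
  have hh : Measurable h := ((hAi.comp measurable_fst).mul
    (hAi.comp (measurable_fst.add measurable_snd))).mul
      (Complex.continuous_conj.measurable.comp (he.measurable.comp measurable_snd))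
  have hint : Integrable h (volume.prod I) := by
    obtain ⟨R, hR⟩ := hA.subset_closedBall 0
    let S : Set (V × V) := Metric.closedBall 0 R ×ˢ Metric.closedBall 0 (2 * R)
    have hS : MeasurableSet S := Metric.isClosed_closedBall.measurableSet.prod
      Metric.isClosed_closedBall.measurableSet
    have hSf : (volume.prod I) S ≠ ∞ := by
      rw [Measure.prod_prod]
      exact (ENNReal.mul_lt_top (isCompact_closedBall _ _).measure_lt_top
        (isCompact_closedBall _ _).measure_lt_top).ne
    refine Integrable.mono' (g := S.indicator fun _ => (1 : ℝ))
      ((integrable_indicator_iff hS).2 (integrableOn_const hSf)) hh.aestronglyMeasurable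
      (Eventually.of_forall fun p => ?_)
    by_cases h1 : p.1 ∈ A
    · by_cases h2 : p.1 + p.2 ∈ A
      · have e1 : ‖p.1‖ ≤ R := by simpa using hR h1
        have e2 : ‖p.1 + p.2‖ ≤ R := by simpa using hR h2
        have e3 : ‖p.2‖ ≤ 2 * R := by
          calc ‖p.2‖ = ‖(p.1 + p.2) - p.1‖ := by rw [add_sub_cancel_left]
            _ ≤ 2 * R := (norm_sub_le _ _).trans (by linarith)
        have hpS : p ∈ S := ⟨by simpa using e1, by simpa using e3⟩
        simp [h, h1, h2, hpS, he1]
      · simp only [h, h2, not_false_eq_true, indicator_of_notMem, mul_zero, zero_mul, norm_zero]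
        exact indicator_nonneg (fun _ _ => zero_le_one) p
    · simp only [h, h1, not_false_eq_true, indicator_of_notMem, zero_mul, norm_zero]
      exact indicator_nonneg (fun _ _ => zero_le_one) p
  have h1 : ∫ p, h p ∂(volume.prod I) =
      ∫ z, Real.fourierChar (-inner ℝ z t) • ((autoConv A z : ℝ) : ℂ) ∂I := by
    rw [integral_prod_symm _ hint]
    refine integral_congr_ae (Eventually.of_forall fun z => ?_)
    simp only [h]
    rw [integral_mul_const, Circle.smul_def, hecj, smul_eq_mul, mul_comm, autoConv_eq hAm,
      ← integral_indicator_one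
        (show MeasurableSet (A ∩ {w | z + w ∈ A}) from hAm.inter (measurable_const_add z hAm)),
      ← integral_complex_ofReal]
    congr 1
    refine integral_congr_ae (Eventually.of_forall fun x => ?_)
    by_cases hx : x ∈ A <;> by_cases hxz : x + z ∈ A <;>
      simp [indicator, hx, hxz, add_comm z]
  have hint' : Integrable (fun p => h (T p))
      (Q ⊗ₘ ((countingKernel V) ×ₖ (countingKernel V))) := by
    rw [← hM] at hint
    exact hint.comp_measurable hT
  rw [← h1, ← hM, integral_map hT.aemeasurable hh.aestronglyMeasurable,
    Measure.integral_compProd hint', ← integral_complex_ofReal]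
  refine integral_congr_ae (Eventually.of_forall fun φ => ?_)
  simp only
  rw [Kernel.prod_apply, countingKernel_apply]
  have h2 : ∀ q : V × V, h (T (φ, q)) = A.indicator e q.1 * starRingEnd ℂ (A.indicator e q.2) := by
    rintro ⟨x, y⟩
    have h3 : starRingEnd ℂ (e (y - x)) = e x * starRingEnd ℂ (e y) := by
      rw [← hecj, ← hecj, inner_sub_left, neg_sub, sub_eq_add_neg, AddChar.map_add_eq_mul,
        Circle.coe_mul]
    by_cases hx : x ∈ A <;> by_cases hy : y ∈ A <;> simp [h, T, hx, hy, h3]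
  simp_rw [h2]
  rw [integral_prod_mul (A.indicator e) (fun y => starRingEnd ℂ (A.indicator e y)), integral_conj,
    Complex.mul_conj, Complex.normSq_eq_norm_sq]

/-- The autocorrelation of a large ball, divided by its volume, is close to one. -/
theorem tendsto_autoConv_ball_div (z : V) :
    Tendsto (fun n : ℕ => autoConv (Metric.ball (0 : V) (n + 1)) z /
      volume.real (Metric.ball (0 : V) (n + 1))) atTop (𝓝 1) := by
  set d := Module.finrank ℝ V
  have hball : ∀ r : ℝ, 0 < r → volume.real (Metric.ball (0 : V) r) =
      r ^ d * volume.real (Metric.ball (0 : V) 1) := fun r hr => by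
    have h := Measure.addHaar_ball_mul_of_pos (volume : Measure V) 0 hr 1
    rw [mul_one] at h
    rw [measureReal_def, h, ENNReal.toReal_mul, ENNReal.toReal_ofReal (by positivity),
      measureReal_def]
  have hv : 0 < volume.real (Metric.ball (0 : V) 1) :=
    ENNReal.toReal_pos (Metric.measure_ball_pos volume _ one_pos).ne'
      Metric.isBounded_ball.measure_lt_top.ne
  have hlow : Tendsto (fun n : ℕ => ((1 : ℝ) - ‖z‖ / (n + 1 : ℝ)) ^ d) atTop (𝓝 1) := by
    have h1 : Tendsto (fun n : ℕ => ‖z‖ / (n + 1 : ℝ)) atTop (𝓝 0) := by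
      have := (tendsto_const_div_atTop_nhds_zero_nat ‖z‖).comp (tendsto_add_atTop_nat 1)
      simpa [Function.comp_def] using this
    simpa using (h1.const_sub 1).pow d
  refine tendsto_of_tendsto_of_tendsto_of_le_of_le' hlow tendsto_const_nhds ?_
    (Eventually.of_forall fun n => ?_)
  · obtain ⟨m, hm⟩ := exists_nat_gt ‖z‖
    filter_upwards [eventually_ge_atTop m] with n hn
    have hn' : (m : ℝ) ≤ n := by exact_mod_cast hn
    have hpos : (0 : ℝ) < n + 1 - ‖z‖ := by linarith
    have hn1 : (0 : ℝ) < n + 1 := by positivity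
    have h2 : volume.real (Metric.ball (0 : V) (n + 1 - ‖z‖)) ≤
        autoConv (Metric.ball (0 : V) (n + 1)) z := by
      rw [autoConv_eq Metric.isOpen_ball.measurableSet]
      refine measureReal_mono (fun w hw => ?_) (volume_inter_ne_top Metric.isBounded_ball _)
      have hw' : ‖w‖ < n + 1 - ‖z‖ := by simpa using hw
      refine ⟨?_, ?_⟩
      · rw [mem_ball_zero_iff]
        linarith [norm_nonneg z]
      · rw [mem_ofPred_eq, mem_ball_zero_iff]
        exact (norm_add_le _ _).trans_lt (by linarith)
    rw [hball _ hpos] at h2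
    rw [hball _ hn1, le_div_iff₀ (by positivity)]
    calc _ = ((n + 1 - ‖z‖) ^ d) * volume.real (Metric.ball (0 : V) 1) := by
          rw [← mul_assoc, ← mul_pow]
          congr 2
          field_simp
      _ ≤ _ := h2
  · exact div_le_one_of_le₀ (autoConv_le Metric.isBounded_ball Metric.isOpen_ball.measurableSet z)
      measureReal_nonneg

/-- The intensity of the Palm measure has a Fourier transform that is a positive measure. -/
theorem exists_isFourierTransform_intensity_palm (hstat : VAddInvariantMeasure V (Config V) Q)
    (hsq : SquareIntegrable Q) (hB : MeasurableSet B) (hB0 : 0 < volume B) (hB1 : volume B < ∞) :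
    ∃ ν : Measure V, IsFourierTransform (intensity (palm B Q)) ν := by
  obtain ⟨C, hC⟩ := exists_intensity_palm_closedBall_le hstat hsq hB hB0 hB1
  have hlf : IsLocallyFiniteMeasure (intensity (palm B Q)) :=
    TranslationBounded.isLocallyFiniteMeasure hC
  have hm : ∀ n : ℕ, MeasurableSet (Metric.ball (0 : V) (n + 1)) := fun n =>
    Metric.isOpen_ball.measurableSet
  refine exists_isFourierTransform hC (k := fun n z => autoConv (Metric.ball (0 : V) (n + 1)) z /
      volume.real (Metric.ball (0 : V) (n + 1)))
    (fun n x => div_nonneg (autoConv_nonneg (hm n) x) measureReal_nonneg)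
    (fun n x => div_le_one_of_le₀ (autoConv_le Metric.isBounded_ball (hm n) x) measureReal_nonneg)
    (fun n => (measurable_autoConv (hm n)).div_const _) (fun n => ?_) tendsto_autoConv_ball_div
    (fun n t => ?_)
  · refine Integrable.div_const ?_ _
    let S : Set V := Metric.closedBall 0 (2 * (n + 1))
    have hS : MeasurableSet S := Metric.isClosed_closedBall.measurableSet
    refine Integrable.mono' (g := S.indicator fun _ => volume.real (Metric.ball (0 : V) (n + 1)))
      ((integrable_indicator_iff hS).2
        (integrableOn_const (isCompact_closedBall _ _).measure_lt_top.ne))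
      (measurable_autoConv (hm n)).aestronglyMeasurable (Eventually.of_forall fun z => ?_)
    rw [Real.norm_of_nonneg (autoConv_nonneg (hm n) z)]
    by_cases hz : z ∈ S
    · rw [indicator_of_mem hz]
      exact autoConv_le Metric.isBounded_ball (hm n) z
    · rw [indicator_of_notMem hz]
      by_contra hc
      refine hz ?_
      simpa [S] using norm_le_of_autoConv_ne_zero (hm n) Metric.ball_subset_closedBall
        (fun h0 => hc h0.le)
  · have h := integral_fourierChar_autoConv hstat hsq hB hB0 hB1
      (Metric.isBounded_ball (x := (0 : V)) (r := n + 1)) (hm n) t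
    refine ⟨(∫ φ, ‖∫ x, (Metric.ball (0 : V) (n + 1)).indicator
      (fun x => (Real.fourierChar (inner ℝ x t) : ℂ)) x ∂(counting φ)‖ ^ 2 ∂Q) /
        volume.real (Metric.ball (0 : V) (n + 1)),
      div_nonneg (integral_nonneg fun φ => by positivity) measureReal_nonneg, ?_⟩
    rw [Complex.ofReal_div, ← h, ← integral_div]
    refine integral_congr_ae (Eventually.of_forall fun z => ?_)
    simp only [Circle.smul_def, smul_eq_mul, Complex.ofReal_div]
    rw [mul_div_assoc]

end PositiveDefinite

/-! ### Tensor products of Schwartz functions -/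

section Tensor

variable {V X Y : Type*} [NormedAddCommGroup V] [NormedSpace ℝ V] [NormedAddCommGroup X]
  [NormedSpace ℝ X] [NormedAddCommGroup Y] [NormedSpace ℝ Y]

/-- Up to a constant, the derivatives of `a ∘ A` decay like those of `a`. -/
theorem exists_pow_mul_norm_iteratedFDeriv_comp_le (a : 𝓢(X, ℂ)) (A : V →L[ℝ] X) (k n : ℕ) :
    ∃ C : ℝ, 0 ≤ C ∧ ∀ i ≤ n, ∀ x : V,
      (1 + ‖A x‖) ^ k * ‖iteratedFDeriv ℝ i (fun x => a (A x)) x‖ ≤ C := by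
  set S := ((Finset.Iic (k, n)).sup fun m => SchwartzMap.seminorm ℝ m.1 m.2) a with hS
  have hS0 : 0 ≤ S := apply_nonneg _ _
  refine ⟨2 ^ k * S * (1 + ‖A‖) ^ n, by positivity, fun i hi x => ?_⟩
  have h1 : iteratedFDeriv ℝ i (fun x => a (A x)) x =
      (iteratedFDeriv ℝ i a (A x)).compContinuousLinearMap fun _ => A :=
    A.iteratedFDeriv_comp_right (a.smooth i) x le_rfl
  have h2 := SchwartzMap.one_add_le_sup_seminorm_apply (𝕜 := ℝ) (m := (k, n)) (k := k) (n := i)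
    le_rfl hi a (A x)
  have h3 : ‖iteratedFDeriv ℝ i (fun x => a (A x)) x‖ ≤
      ‖iteratedFDeriv ℝ i a (A x)‖ * (1 + ‖A‖) ^ n := by
    rw [h1]
    refine (ContinuousMultilinearMap.norm_compContinuousLinearMap_le _ _).trans ?_
    gcongr
    rw [Finset.prod_const, Finset.card_univ, Fintype.card_fin]
    calc ‖A‖ ^ i ≤ (1 + ‖A‖) ^ i := by gcongr; linarith [norm_nonneg A]
      _ ≤ (1 + ‖A‖) ^ n := pow_le_pow_right₀ (by linarith [norm_nonneg A]) hi
  calc _ ≤ (1 + ‖A x‖) ^ k * (‖iteratedFDeriv ℝ i a (A x)‖ * (1 + ‖A‖) ^ n) := by gcongr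
    _ = ((1 + ‖A x‖) ^ k * ‖iteratedFDeriv ℝ i a (A x)‖) * (1 + ‖A‖) ^ n := by ring
    _ ≤ _ := by gcongr

theorem exists_schwartz_tensor (a : 𝓢(X, ℂ)) (b : 𝓢(Y, ℂ)) (A : V →L[ℝ] X) (B : V →L[ℝ] Y)
    (hAB : ∀ x, ‖x‖ ≤ ‖A x‖ + ‖B x‖) : ∃ h : 𝓢(V, ℂ), ∀ x, h x = a (A x) * b (B x) := by
  have ha : ContDiff ℝ (⊤ : ℕ∞) fun x => a (A x) := (a.smooth _).comp A.contDiff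
  have hb : ContDiff ℝ (⊤ : ℕ∞) fun x => b (B x) := (b.smooth _).comp B.contDiff
  refine ⟨⟨fun x => a (A x) * b (B x), ha.mul hb, fun k n => ?_⟩, fun x => rfl⟩
  obtain ⟨Ca, hCa0, hCa⟩ := exists_pow_mul_norm_iteratedFDeriv_comp_le a A k n
  obtain ⟨Cb, hCb0, hCb⟩ := exists_pow_mul_norm_iteratedFDeriv_comp_le b B k n
  refine ⟨∑ i ∈ Finset.range (n + 1), (n.choose i : ℝ) * (Ca * Cb), fun x => ?_⟩
  have h1 := norm_iteratedFDeriv_mul_le (N := (⊤ : ℕ∞)) ha hb x (n := n) (by exact_mod_cast le_top)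
  have h2 : ‖x‖ ^ k ≤ (1 + ‖A x‖) ^ k * (1 + ‖B x‖) ^ k := by
    rw [← mul_pow]
    refine pow_le_pow_left₀ (norm_nonneg _) ((hAB x).trans ?_) k
    nlinarith [mul_nonneg (norm_nonneg (A x)) (norm_nonneg (B x))]
  calc _ ≤ ((1 + ‖A x‖) ^ k * (1 + ‖B x‖) ^ k) * ∑ i ∈ Finset.range (n + 1), (n.choose i : ℝ) *
        ‖iteratedFDeriv ℝ i (fun x => a (A x)) x‖ *
          ‖iteratedFDeriv ℝ (n - i) (fun x => b (B x)) x‖ := by gcongr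
    _ = ∑ i ∈ Finset.range (n + 1), (n.choose i : ℝ) *
        (((1 + ‖A x‖) ^ k * ‖iteratedFDeriv ℝ i (fun x => a (A x)) x‖) *
          ((1 + ‖B x‖) ^ k * ‖iteratedFDeriv ℝ (n - i) (fun x => b (B x)) x‖)) := by
        rw [Finset.mul_sum]
        exact Finset.sum_congr rfl fun i _ => by ring
    _ ≤ _ := by
        refine Finset.sum_le_sum fun i hi => ?_
        have hi' : i ≤ n := Nat.lt_succ_iff.1 (Finset.mem_range.1 hi)
        have e1 := hCa i hi' x
        have e2 := hCb (n - i) (Nat.sub_le _ _) x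
        gcongr

end Tensor

section FourierDecomposition

variable {V : Type*} [NormedAddCommGroup V] [InnerProductSpace ℝ V] [FiniteDimensional ℝ V]
  [MeasurableSpace V] [BorelSpace V] {E F : Submodule ℝ V} {hEF : IsCompl E F} {α : ℝ≥0∞}

/-- The Fourier transform of a function of the form `a(x_F) b(x_E)` is expressed with the
*orthogonal* projections, which are adjoint to the inclusions of `E` and `F`. -/
theorem fourierInv_tensor (hvol : (volume : Measure V) = α •
      ((volume : Measure E).prod (volume : Measure F)).map fun p => (p.1 : V) + p.2)
    {h : 𝓢(V, ℂ)} {a : F → ℂ} {b : E → ℂ}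
    (hh : ∀ x, h x = a (F.projectionOnto E hEF.symm x) * b (E.projectionOnto F hEF x)) (t : V) :
    𝓕⁻ h t = (α.toReal : ℂ) * (𝓕⁻ a (F.orthogonalProjectionOnto t) *
      𝓕⁻ b (E.orthogonalProjectionOnto t)) := by
  have hm : Measurable fun p : E × F => (p.1 : V) + p.2 :=
    (measurable_subtype_coe.comp measurable_fst).add (measurable_subtype_coe.comp measurable_snd)
  have hG : Continuous fun x : V => Real.fourierChar (inner ℝ x t) • h x := by
    have := h.continuous
    fun_prop
  rw [SchwartzMap.fourierInv_coe, Real.fourierInv_eq, Real.fourierInv_eq, Real.fourierInv_eq, hvol,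
    integral_smul_measure, integral_map hm.aemeasurable hG.aestronglyMeasurable, Complex.real_smul]
  congr 1
  rw [mul_comm, ← integral_prod_mul
    (fun u : E => Real.fourierChar (inner ℝ u (E.orthogonalProjectionOnto t)) • b u)
    (fun v : F => Real.fourierChar (inner ℝ v (F.orthogonalProjectionOnto t)) • a v)]
  refine integral_congr_ae (Eventually.of_forall fun p => ?_)
  simp only
  rw [hh, projectionOnto_add hEF, projectionOnto_symm_add hEF, inner_add_left,
    AddChar.map_add_eq_mul, Submodule.inner_orthogonalProjectionOnto_eq_of_mem_left,
    Submodule.inner_orthogonalProjectionOnto_eq_of_mem_left, Circle.smul_def, Circle.smul_def,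
    Circle.smul_def, Circle.coe_mul]
  simp only [smul_eq_mul]
  ring

end FourierDecomposition

/-! ### Autocorrelations and their Fourier transforms -/

section AutoCorr

variable {X : Type*} [NormedAddCommGroup X] [InnerProductSpace ℝ X] [FiniteDimensional ℝ X]
  [MeasurableSpace X] [BorelSpace X]

/-- The autocorrelation `u * ũ` of a real function, where `ũ(x) = u(-x)`. -/
noncomputable def autoCorr (u : X → ℝ) : X → ℝ :=
  convolution u (fun x => u (-x)) (ContinuousLinearMap.lsmul ℝ ℝ) volume

theorem autoConv_eq_autoCorr (W : Set X) :
    autoConv W = autoCorr (W.indicator fun _ => (1 : ℝ)) := by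
  have h : (-W).indicator (fun _ => (1 : ℝ)) = fun x => W.indicator (fun _ => (1 : ℝ)) (-x) := by
    ext x
    exact indicator_comp_right (s := W) (g := fun _ => (1 : ℝ)) Neg.neg
  rw [autoConv, autoCorr, lebesgue_eq_volume, h]

theorem autoCorr_apply (u : X → ℝ) (x : X) : autoCorr u x = ∫ t, u t * u (t - x) := by
  simp [autoCorr, convolution]

theorem ofReal_convolution (u v : X → ℝ) :
    (fun x => ((convolution u v (ContinuousLinearMap.lsmul ℝ ℝ) volume x : ℝ) : ℂ)) =
      convolution (fun x => (u x : ℂ)) (fun x => (v x : ℂ)) (ContinuousLinearMap.mul ℂ ℂ)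
        volume := by
  ext x
  simp only [convolution, ContinuousLinearMap.lsmul_apply, smul_eq_mul,
    ContinuousLinearMap.mul_apply']
  rw [← integral_complex_ofReal]
  simp

theorem fourier_comp_neg (f : X → ℂ) (ξ : X) : 𝓕 (fun x => f (-x)) ξ = 𝓕 f (-ξ) := by
  rw [Real.fourier_eq, Real.fourier_eq, ← integral_neg_eq_self]
  simp

theorem fourier_ofReal_neg (u : X → ℝ) (ξ : X) :
    𝓕 (fun x => (u x : ℂ)) (-ξ) = starRingEnd ℂ (𝓕 (fun x => (u x : ℂ)) ξ) := by
  rw [Real.fourier_eq, Real.fourier_eq, ← integral_conj]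
  refine integral_congr_ae (Eventually.of_forall fun x => ?_)
  simp only [inner_neg_right, Circle.smul_def, smul_eq_mul, map_mul, Complex.conj_ofReal]
  rw [neg_neg, AddChar.map_neg_eq_inv, Circle.coe_inv_eq_conj, Complex.conj_conj]

theorem fourier_autoCorr {u : X → ℝ} (hu : Integrable u) (ξ : X) :
    𝓕 (fun x => (autoCorr u x : ℂ)) ξ = ((‖𝓕 (fun x => (u x : ℂ)) ξ‖ ^ 2 : ℝ) : ℂ) := by
  have h1 : Integrable fun x => (u x : ℂ) := hu.ofReal
  unfold autoCorr
  rw [ofReal_convolution, Real.fourier_mul_convolution_eq h1 h1.comp_neg,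
    fourier_comp_neg (fun x => (u x : ℂ)), fourier_ofReal_neg, Complex.mul_conj,
    Complex.normSq_eq_norm_sq]

theorem fourierInv_autoCorr {u : X → ℝ} (hu : Integrable u) (ξ : X) :
    𝓕⁻ (fun x => (autoCorr u x : ℂ)) ξ = ((‖𝓕 (fun x => (u x : ℂ)) ξ‖ ^ 2 : ℝ) : ℂ) := by
  rw [Real.fourierInv_eq_fourier_neg, fourier_autoCorr hu, fourier_ofReal_neg, RCLike.norm_conj]

theorem norm_autoCorr_le {u : X → ℝ} (hu1 : ∀ x, |u x| ≤ 1) {R : ℝ}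
    (huR : ∀ x, x ∉ Metric.closedBall 0 R → u x = 0) (x : X) :
    |autoCorr u x| ≤ volume.real (Metric.closedBall (0 : X) R) *
      (Metric.closedBall (0 : X) (2 * R)).indicator 1 x := by
  have hB : MeasurableSet (Metric.closedBall (0 : X) R) :=
    Metric.isClosed_closedBall.measurableSet
  by_cases hx : x ∈ Metric.closedBall (0 : X) (2 * R)
  · rw [indicator_of_mem hx, Pi.one_apply, mul_one, autoCorr_apply, ← integral_indicator_one hB,
      ← Real.norm_eq_abs]
    refine norm_integral_le_of_norm_le ((integrable_indicator_iff hB).2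
      (integrableOn_const (isCompact_closedBall _ _).measure_lt_top.ne))
      (Eventually.of_forall fun t => ?_)
    by_cases ht : t ∈ Metric.closedBall (0 : X) R
    · rw [indicator_of_mem ht, Pi.one_apply, norm_mul]
      exact mul_le_one₀ (hu1 t) (norm_nonneg _) (hu1 _)
    · simp [huR t ht, ht]
  · rw [indicator_of_notMem hx, mul_zero, autoCorr_apply]
    refine (abs_eq_zero.2 (integral_eq_zero_of_ae (Eventually.of_forall fun t => ?_))).le
    by_cases ht : t ∈ Metric.closedBall (0 : X) R
    · have ht' : t - x ∉ Metric.closedBall (0 : X) R := fun h => hx (by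
        rw [mem_closedBall_zero_iff] at ht h ⊢
        calc ‖x‖ = ‖t - (t - x)‖ := by rw [sub_sub_cancel]
          _ ≤ 2 * R := (norm_sub_le _ _).trans (by linarith))
      simp [huR _ ht']
    · simp [huR t ht]

/-- Smooth approximations of the indicator of a bounded set by mollification, with controlled
Fourier transforms. -/
theorem exists_mollified_indicator {W : Set X} (hWb : IsBounded W) (hWm : MeasurableSet W) :
    ∃ (u : ℕ → X → ℝ) (R : ℝ), 0 < R ∧ (∀ n, ContDiff ℝ (⊤ : ℕ∞) (u n)) ∧
      (∀ n x, |u n x| ≤ 1) ∧ (∀ n x, x ∉ Metric.closedBall 0 R → u n x = 0) ∧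
      (∀ᵐ x, Tendsto (fun n => u n x) atTop (𝓝 (W.indicator (fun _ => (1 : ℝ)) x))) ∧
      (∀ n ξ, ‖𝓕 (fun x => (u n x : ℂ)) ξ‖ ≤
        ‖𝓕 (fun x => ((W.indicator (fun _ => (1 : ℝ)) x : ℝ) : ℂ)) ξ‖) := by
  obtain ⟨R, hR0, hR⟩ := hWb.subset_closedBall_lt 0 0
  let w : X → ℝ := W.indicator fun _ => 1
  have hw : Integrable w := (integrable_indicator_iff hWm).2
    (integrableOn_const hWb.measure_lt_top.ne)
  let ρ : ℕ → ContDiffBump (0 : X) := fun n =>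
    ⟨1 / (2 * (n + 1)), 1 / (n + 1), by positivity, by
      refine one_div_lt_one_div_of_lt (by positivity) ?_
      have : (0 : ℝ) < n + 1 := by positivity
      linarith⟩
  have hρ1 : ∀ n, (ρ n).rOut ≤ 1 := fun n => by
    simp only [ρ]
    rw [div_le_one (by positivity)]
    linarith [(Nat.cast_nonneg n : (0 : ℝ) ≤ n)]
  let u : ℕ → X → ℝ := fun n =>
    convolution ((ρ n).normed volume) w (ContinuousLinearMap.lsmul ℝ ℝ) volume
  refine ⟨u, R + 1, by linarith, fun n => ?_, fun n x => ?_, fun n x hx => ?_, ?_, fun n ξ => ?_⟩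
  · exact (ρ n).hasCompactSupport_normed.contDiff_convolution_left _ (ρ n).contDiff_normed
      hw.locallyIntegrable
  · simp only [u, convolution, ContinuousLinearMap.lsmul_apply, smul_eq_mul]
    rw [← (ρ n).integral_normed (μ := volume), ← Real.norm_eq_abs]
    refine norm_integral_le_of_norm_le (ρ n).integrable_normed (Eventually.of_forall fun t => ?_)
    rw [norm_mul, Real.norm_of_nonneg ((ρ n).nonneg_normed t)]
    refine mul_le_of_le_one_right ((ρ n).nonneg_normed t) ?_
    by_cases h : x - t ∈ W <;> simp [w, h]
  · by_contra hne
    obtain ⟨y, hy, z, hz, rfl⟩ := support_convolution_subset _ (Function.mem_support.2 hne)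
    refine hx ?_
    rw [(ρ n).support_normed_eq, mem_ball_zero_iff] at hy
    have hz' : z ∈ W := by
      by_contra h
      exact hz (indicator_of_notMem h _)
    have hz'' : ‖z‖ ≤ R := by simpa using hR hz'
    rw [mem_closedBall_zero_iff]
    exact (norm_add_le _ _).trans (by linarith [hρ1 n])
  · refine ContDiffBump.ae_convolution_tendsto_right_of_locallyIntegrable (K := 2) ?_
      (Eventually.of_forall fun n => ?_) hw.locallyIntegrable
    · exact tendsto_one_div_add_atTop_nhds_zero_nat
    · simp only [ρ]
      refine le_of_eq ?_
      field_simp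
  · have h1 : Integrable fun x => (((ρ n).normed volume x : ℝ) : ℂ) :=
      (ρ n).integrable_normed.ofReal
    have h2 : Integrable fun x => ((w x : ℝ) : ℂ) := hw.ofReal
    simp only [u]
    rw [ofReal_convolution, Real.fourier_mul_convolution_eq h1 h2, norm_mul]
    refine mul_le_of_le_one_left (norm_nonneg _) ?_
    refine (VectorFourier.norm_fourierIntegral_le_integral_norm _ _ _ _ _).trans_eq ?_
    simp_rw [Complex.norm_real, Real.norm_of_nonneg ((ρ n).nonneg_normed _)]
    exact (ρ n).integral_normed

end AutoCorr

/-! ### Convergence of mollified autocorrelations -/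

section AutoCorrLimits

variable {X : Type*} [NormedAddCommGroup X] [InnerProductSpace ℝ X] [FiniteDimensional ℝ X]
  [MeasurableSpace X] [BorelSpace X]

/-- `ψ̂ = |𝓕 1_W|²`. -/
theorem autoConvFourier_eq {W : Set X} (hWb : IsBounded W) (hWm : MeasurableSet W) (ξ : X) :
    autoConvFourier W ξ =
      ((‖𝓕 (fun x => ((W.indicator (fun _ => (1 : ℝ)) x : ℝ) : ℂ)) ξ‖ ^ 2 : ℝ) : ℂ) := by
  have hw : Integrable (W.indicator fun _ => (1 : ℝ)) := (integrable_indicator_iff hWm).2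
    (integrableOn_const hWb.measure_lt_top.ne)
  rw [autoConvFourier, autoConv_eq_autoCorr, fourier_autoCorr hw]

theorem continuous_autoConvFourier {W : Set X} (hWb : IsBounded W) (hWm : MeasurableSet W) :
    Continuous (autoConvFourier W) := by
  have hw : Integrable (W.indicator fun _ => (1 : ℝ)) := (integrable_indicator_iff hWm).2
    (integrableOn_const hWb.measure_lt_top.ne)
  have hw' : Integrable fun x => ((W.indicator (fun _ => (1 : ℝ)) x : ℝ) : ℂ) := hw.ofReal
  have h : Continuous (𝓕 fun x => ((W.indicator (fun _ => (1 : ℝ)) x : ℝ) : ℂ)) :=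
    VectorFourier.fourierIntegral_continuous Real.continuous_fourierChar
      (by exact continuous_inner) hw'
  rw [funext (autoConvFourier_eq hWb hWm)]
  exact Complex.continuous_ofReal.comp (h.norm.pow 2)

theorem integrable_of_support_closedBall {u : X → ℝ} (hu : Measurable u) (hu1 : ∀ x, |u x| ≤ 1)
    {R : ℝ} (huR : ∀ x, x ∉ Metric.closedBall 0 R → u x = 0) : Integrable u := by
  have hB : MeasurableSet (Metric.closedBall (0 : X) R) :=
    Metric.isClosed_closedBall.measurableSet
  refine Integrable.mono' (g := (Metric.closedBall (0 : X) R).indicator 1)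
    ((integrable_indicator_iff hB).2
      (integrableOn_const (isCompact_closedBall _ _).measure_lt_top.ne))
    hu.aestronglyMeasurable (Eventually.of_forall fun x => ?_)
  by_cases hx : x ∈ Metric.closedBall (0 : X) R
  · simpa [indicator_of_mem hx] using hu1 x
  · simp [huR x hx, hx]

theorem exists_schwartz_autoCorr {u : X → ℝ} (hu : ContDiff ℝ (⊤ : ℕ∞) u) {R : ℝ}
    (huR : ∀ x, x ∉ Metric.closedBall 0 R → u x = 0) :
    ∃ Ψ : 𝓢(X, ℂ), ∀ x, Ψ x = (autoCorr u x : ℂ) := by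
  have hc : HasCompactSupport u :=
    HasCompactSupport.intro (isCompact_closedBall (0 : X) R) fun x hx => huR x hx
  have hc' : HasCompactSupport fun x => u (-x) := hc.comp_homeomorph (Homeomorph.neg X)
  have h1 : ContDiff ℝ (⊤ : ℕ∞) (autoCorr u) :=
    hc.contDiff_convolution_left _ hu (hu.continuous.comp continuous_neg).locallyIntegrable
  have h2 : HasCompactSupport (autoCorr u) := hc.convolution _ hc'
  exact ⟨HasCompactSupport.toSchwartzMap (f := fun x => (autoCorr u x : ℂ))
    (h2.comp_left Complex.ofReal_zero) (Complex.ofRealCLM.contDiff.comp h1), fun x => rfl⟩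

variable {u : ℕ → X → ℝ} {w : X → ℝ} {R : ℝ}

theorem tendsto_autoCorr (hu : ∀ n, Measurable (u n)) (hu1 : ∀ n x, |u n x| ≤ 1)
    (huR : ∀ n x, x ∉ Metric.closedBall 0 R → u n x = 0)
    (huw : ∀ᵐ x, Tendsto (fun n => u n x) atTop (𝓝 (w x))) (x : X) :
    Tendsto (fun n => autoCorr (u n) x) atTop (𝓝 (autoCorr w x)) := by
  have hB : MeasurableSet (Metric.closedBall (0 : X) R) :=
    Metric.isClosed_closedBall.measurableSet
  simp_rw [autoCorr_apply]
  refine tendsto_integral_of_dominated_convergence ((Metric.closedBall (0 : X) R).indicator 1)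
    (fun n => ?_) ((integrable_indicator_iff hB).2
      (integrableOn_const (isCompact_closedBall _ _).measure_lt_top.ne))
    (fun n => Eventually.of_forall fun t => ?_) ?_
  · exact ((hu n).mul ((hu n).comp (measurable_id.sub_const x))).aestronglyMeasurable
  · by_cases ht : t ∈ Metric.closedBall (0 : X) R
    · rw [indicator_of_mem ht, Pi.one_apply, norm_mul]
      exact mul_le_one₀ (hu1 n t) (norm_nonneg _) (hu1 n _)
    · simp [huR n t ht, ht]
  · filter_upwards [huw, (measurePreserving_sub_right volume x).quasiMeasurePreserving.ae huw]
      with t h1 h2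
    exact h1.mul h2

theorem tendsto_fourier_of_dominated (hu : ∀ n, Measurable (u n)) (hu1 : ∀ n x, |u n x| ≤ 1)
    (huR : ∀ n x, x ∉ Metric.closedBall 0 R → u n x = 0)
    (huw : ∀ᵐ x, Tendsto (fun n => u n x) atTop (𝓝 (w x))) (ξ : X) :
    Tendsto (fun n => 𝓕 (fun x => (u n x : ℂ)) ξ) atTop (𝓝 (𝓕 (fun x => (w x : ℂ)) ξ)) := by
  have hB : MeasurableSet (Metric.closedBall (0 : X) R) :=
    Metric.isClosed_closedBall.measurableSet
  simp_rw [Real.fourier_eq]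
  refine tendsto_integral_of_dominated_convergence ((Metric.closedBall (0 : X) R).indicator 1)
    (fun n => ?_) ((integrable_indicator_iff hB).2
      (integrableOn_const (isCompact_closedBall _ _).measure_lt_top.ne))
    (fun n => Eventually.of_forall fun t => ?_) ?_
  · have h1 : Measurable fun x => (u n x : ℂ) := Complex.measurable_ofReal.comp (hu n)
    have h2 : Continuous fun x : X => (Real.fourierChar (-inner ℝ x ξ) : ℂ) := by fun_prop
    simp_rw [Circle.smul_def]
    exact (h2.measurable.mul h1).aestronglyMeasurable
  · rw [Circle.norm_smul, Complex.norm_real, Real.norm_eq_abs]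
    by_cases ht : t ∈ Metric.closedBall (0 : X) R
    · simpa [indicator_of_mem ht] using hu1 n t
    · simp [huR n t ht, ht]
  · filter_upwards [huw] with t h1
    exact ((Complex.continuous_ofReal.tendsto _).comp h1).const_smul _

theorem norm_autoCorr_le_bumpAt {u : X → ℝ} (hu1 : ∀ x, |u x| ≤ 1) (hR : 0 < 2 * R)
    (huR : ∀ x, x ∉ Metric.closedBall 0 R → u x = 0) (x : X) :
    ‖(autoCorr u x : ℂ)‖ ≤
      volume.real (Metric.closedBall (0 : X) R) * ‖bumpAt (2 * R) hR (0 : X) x‖ := by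
  rw [Complex.norm_real, Real.norm_eq_abs]
  refine (norm_autoCorr_le hu1 huR x).trans ?_
  gcongr
  by_cases hx : x ∈ Metric.closedBall (0 : X) (2 * R)
  · rw [bumpAt_apply, ballBump_eq_one hR hx]
    simp [hx]
  · simp [indicator_of_notMem hx]

end AutoCorrLimits

/-! ### Fourier transforms and the decomposition `E ⊕ F` -/

section Transfer

variable {V : Type*} [NormedAddCommGroup V] [InnerProductSpace ℝ V] [FiniteDimensional ℝ V]
  [MeasurableSpace V] [BorelSpace V]

theorem IsFourierTransform.integral_fourier {I ν : Measure V} (h : IsFourierTransform I ν)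
    (g : 𝓢(V, ℂ)) : ∫ x, 𝓕 g x ∂I = ∫ t, g t ∂ν := by
  obtain ⟨h1, h2, h3⟩ := h
  exact DFunLike.congr_fun h3 g

variable {E F : Submodule ℝ V} (hEF : IsCompl E F) {α : ℝ≥0∞}

theorem norm_le_norm_projectionOnto_add (x : V) :
    ‖x‖ ≤ ‖F.projectionOnto E hEF.symm x‖ + ‖E.projectionOnto F hEF x‖ := by
  have h : (E.projectionOnto F hEF x : V) + F.projectionOnto E hEF.symm x = x :=
    Submodule.projection_add_projection_eq_self hEF x
  calc ‖x‖ = ‖(E.projectionOnto F hEF x : V) + F.projectionOnto E hEF.symm x‖ := by rw [h]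
    _ ≤ ‖E.projectionOnto F hEF x‖ + ‖F.projectionOnto E hEF.symm x‖ := norm_add_le _ _
    _ = _ := add_comm _ _

/-- The product `a(x_F) b(x_E)` of Schwartz functions on `F` and on `E`. -/
theorem exists_schwartz_projectionOnto (a : 𝓢(F, ℂ)) (b : 𝓢(E, ℂ)) : ∃ h : 𝓢(V, ℂ),
    ∀ x, h x = a (F.projectionOnto E hEF.symm x) * b (E.projectionOnto F hEF x) :=
  exists_schwartz_tensor a b (LinearMap.toContinuousLinearMap (F.projectionOnto E hEF.symm))
    (LinearMap.toContinuousLinearMap (E.projectionOnto F hEF))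
    (norm_le_norm_projectionOnto_add hEF)

/-- The case of a smooth window function `u` of the formula for the Fourier transform of the
projected measure: apply the Fourier transform of `I` to `x ↦ (u * ũ)(x_F) 𝓕 g(x_E)`. -/
theorem integral_autoCorr_mul_fourier {I ν : Measure V} (hI : IsFourierTransform I ν)
    (hvol : (volume : Measure V) = α •
      ((volume : Measure E).prod (volume : Measure F)).map fun p => (p.1 : V) + p.2)
    {u : F → ℝ} (hu : ContDiff ℝ (⊤ : ℕ∞) u) {R : ℝ} (hu1 : ∀ x, |u x| ≤ 1)
    (huR : ∀ x, x ∉ Metric.closedBall 0 R → u x = 0) (g : 𝓢(E, ℂ)) (hα0 : α ≠ 0) (hα : α ≠ ∞) :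
    Integrable (fun t => ((‖𝓕 (fun x => (u x : ℂ)) (F.orthogonalProjectionOnto t)‖ ^ 2 : ℝ) : ℂ) *
        g (E.orthogonalProjectionOnto t)) ν ∧
    ∫ x, (autoCorr u (F.projectionOnto E hEF.symm x) : ℂ) *
        𝓕 g (E.projectionOnto F hEF x) ∂I =
      α.toReal * ∫ t, ((‖𝓕 (fun x => (u x : ℂ)) (F.orthogonalProjectionOnto t)‖ ^ 2 : ℝ) : ℂ) *
        g (E.orthogonalProjectionOnto t) ∂ν := by
  obtain ⟨Ψ, hΨ⟩ := exists_schwartz_autoCorr hu huR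
  obtain ⟨H, hH⟩ := exists_schwartz_projectionOnto hEF Ψ (𝓕 g)
  have hui := integrable_of_support_closedBall hu.continuous.measurable hu1 huR
  have hα' : (α.toReal : ℂ) ≠ 0 := by
    exact_mod_cast (ENNReal.toReal_pos hα0 hα).ne'
  have h1 : ∀ t, 𝓕⁻ H t = (α.toReal : ℂ) *
      (((‖𝓕 (fun x => (u x : ℂ)) (F.orthogonalProjectionOnto t)‖ ^ 2 : ℝ) : ℂ) *
        g (E.orthogonalProjectionOnto t)) := fun t => by
    rw [fourierInv_tensor hvol hH, ← SchwartzMap.fourierInv_coe (𝓕 g),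
      FourierTransform.fourierInv_fourier_eq, ← fourierInv_autoCorr hui, funext hΨ]
  have h2 := hI.integral_fourier (𝓕⁻ H)
  rw [FourierTransform.fourier_fourierInv_eq] at h2
  obtain ⟨_, hν, _⟩ := hI
  refine ⟨?_, ?_⟩
  · have h3 := ((SchwartzMap.integrable (μ := ν) (𝓕⁻ H)).const_mul (α.toReal : ℂ)⁻¹)
    refine h3.congr (Eventually.of_forall fun t => ?_)
    simp only
    rw [h1, inv_mul_cancel_left₀ hα']
  · simp_rw [← hΨ, ← hH]
    rw [h2, ← integral_const_mul]
    exact integral_congr_ae (Eventually.of_forall h1)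

end Transfer

/-! ### The Fourier transform of the projected measure -/

section ProjectedMeasure

variable {V : Type*} [NormedAddCommGroup V] [InnerProductSpace ℝ V] [FiniteDimensional ℝ V]
  [MeasurableSpace V] [BorelSpace V] {E F : Submodule ℝ V} (hEF : IsCompl E F) {α : ℝ≥0∞}

/-- This function dominates `(u * ũ)(x_F) b(x_E)` when `u` is supported in a fixed ball. -/
theorem integrable_autoCorr_bound {I : Measure V} (hI : I.HasTemperateGrowth) {r : ℝ} (hr : 0 < r)
    (b : 𝓢(E, ℂ)) :
    Integrable (fun x => ‖bumpAt r hr (0 : F) (F.projectionOnto E hEF.symm x)‖ *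
      ‖b (E.projectionOnto F hEF x)‖) I := by
  obtain ⟨H, hH⟩ := exists_schwartz_projectionOnto hEF (bumpAt r hr (0 : F)) b
  refine (SchwartzMap.integrable (μ := I) H).norm.congr (Eventually.of_forall fun x => ?_)
  simp only
  rw [hH, norm_mul]

/-- The measure `ψ̂(x_F⊥) ν(dx)` on the space, projected orthogonally to `E`, is translation
bounded. This comes from Fatou's lemma applied to smooth approximations of the window. -/
theorem exists_lintegral_autoConvFourier_le (hEF : IsCompl E F) {I ν : Measure V}
    (hI : IsFourierTransform I ν)
    (hvol : (volume : Measure V) = α •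
      ((volume : Measure E).prod (volume : Measure F)).map fun p => (p.1 : V) + p.2)
    (hα0 : α ≠ 0) (hα : α ≠ ∞) {W : Set F} (hWb : IsBounded W) (hWm : MeasurableSet W) :
    ∃ M : NNReal, ∀ y : E,
      ∫⁻ t, ENNReal.ofReal (autoConvFourier W (F.orthogonalProjectionOnto t)).re *
        ENNReal.ofReal (ballBump E 1 one_pos (E.orthogonalProjectionOnto t - y)) ∂ν ≤ M := by
  obtain ⟨u, R, hR, hu, hu1, huR, huw, -⟩ := exists_mollified_indicator hWb hWm
  have hR2 : 0 < 2 * R := by positivity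
  have hα' : 0 < α.toReal := ENNReal.toReal_pos hα0 hα
  set v := volume.real (Metric.closedBall (0 : F) R) with hv
  set K := ∫ x, ‖bumpAt (2 * R) hR2 (0 : F) (F.projectionOnto E hEF.symm x)‖ *
      ‖𝓕 (bumpAt 1 one_pos (0 : E)) (E.projectionOnto F hEF x)‖ ∂I with hK
  have hb := integrable_autoCorr_bound hEF hI.choose hR2 (𝓕 (bumpAt 1 one_pos (0 : E)))
  have hcu : ∀ n, Continuous (𝓕 fun x => (u n x : ℂ)) := fun n =>
    VectorFourier.fourierIntegral_continuous Real.continuous_fourierChar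
      (by exact continuous_inner)
      ((integrable_of_support_closedBall (hu n).continuous.measurable (hu1 n) (huR n)).ofReal
        (𝕜 := ℂ))
  let s : ℕ → F → ℝ := fun n ξ => ‖𝓕 (fun x => (u n x : ℂ)) ξ‖ ^ 2
  have hsc : ∀ n, Continuous (s n) := fun n => (hcu n).norm.pow 2
  refine ⟨(α.toReal⁻¹ * (v * K)).toNNReal, fun y => ?_⟩
  let b : E → ℝ := fun z => ballBump E 1 one_pos (z - y)
  have hbc : Continuous b :=
    (ballBump E 1 one_pos).continuous.comp (continuous_id.sub continuous_const)
  have hb0 : ∀ z, 0 ≤ b z := fun z => (ballBump E 1 one_pos).nonneg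
  have h1 : ∀ n, ∫⁻ t, ENNReal.ofReal (s n (F.orthogonalProjectionOnto t)) *
      ENNReal.ofReal (b (E.orthogonalProjectionOnto t)) ∂ν ≤
        ENNReal.ofReal (α.toReal⁻¹ * (v * K)) := fun n => by
    obtain ⟨e1, e2⟩ := integral_autoCorr_mul_fourier hEF hI hvol (hu n) (hu1 n) (huR n)
      (bumpAt 1 one_pos y) hα0 hα
    have e3 : ∀ t, ((‖𝓕 (fun x => (u n x : ℂ)) (F.orthogonalProjectionOnto t)‖ ^ 2 : ℝ) : ℂ) *
        bumpAt 1 one_pos y (E.orthogonalProjectionOnto t) =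
        ((s n (F.orthogonalProjectionOnto t) * b (E.orthogonalProjectionOnto t) : ℝ) : ℂ) :=
      fun t => by
        rw [Complex.ofReal_mul]
        rfl
    simp_rw [e3] at e1 e2
    have e4 : Integrable (fun t => s n (F.orthogonalProjectionOnto t) *
        b (E.orthogonalProjectionOnto t)) ν := by simpa using e1.re
    rw [integral_complex_ofReal] at e2
    have e5 : ∀ t, 0 ≤ s n (F.orthogonalProjectionOnto t) * b (E.orthogonalProjectionOnto t) :=
      fun t => mul_nonneg (sq_nonneg _) (hb0 _)
    have e6 : ∀ t, ENNReal.ofReal (s n (F.orthogonalProjectionOnto t)) *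
        ENNReal.ofReal (b (E.orthogonalProjectionOnto t)) = ENNReal.ofReal
          (s n (F.orthogonalProjectionOnto t) * b (E.orthogonalProjectionOnto t)) := fun t =>
      (ENNReal.ofReal_mul (sq_nonneg _)).symm
    simp_rw [e6]
    rw [← ofReal_integral_eq_lintegral_ofReal e4 (Eventually.of_forall e5)]
    refine ENNReal.ofReal_le_ofReal ?_
    rw [← mul_le_mul_iff_right₀ hα', mul_inv_cancel_left₀ hα'.ne']
    calc α.toReal * ∫ t, s n (F.orthogonalProjectionOnto t) *
          b (E.orthogonalProjectionOnto t) ∂ν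
        ≤ ‖((α.toReal : ℂ) * ((∫ t, s n (F.orthogonalProjectionOnto t) *
          b (E.orthogonalProjectionOnto t) ∂ν : ℝ) : ℂ))‖ := by
          rw [← Complex.ofReal_mul, Complex.norm_real]
          exact le_abs_self _
      _ ≤ ∫ x, v * (‖bumpAt (2 * R) hR2 (0 : F) (F.projectionOnto E hEF.symm x)‖ *
            ‖𝓕 (bumpAt 1 one_pos (0 : E)) (E.projectionOnto F hEF x)‖) ∂I := by
          rw [← e2]
          refine norm_integral_le_of_norm_le (hb.const_mul v) (Eventually.of_forall fun x => ?_)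
          rw [norm_mul, norm_fourier_bumpAt, ← mul_assoc]
          gcongr
          exact norm_autoCorr_le_bumpAt (hu1 n) hR2 (huR n) _
      _ = v * K := integral_const_mul _ _
  have hlim : ∀ ξ, Tendsto (fun n => ENNReal.ofReal (s n ξ)) atTop
      (𝓝 (ENNReal.ofReal (autoConvFourier W ξ).re)) := fun ξ => by
    rw [autoConvFourier_eq hWb hWm, Complex.ofReal_re]
    exact (ENNReal.continuous_ofReal.tendsto _).comp
      ((tendsto_fourier_of_dominated (fun n => (hu n).continuous.measurable) hu1 huR huw
        ξ).norm.pow 2)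
  have h2 : ∀ t, ENNReal.ofReal (autoConvFourier W (F.orthogonalProjectionOnto t)).re *
      ENNReal.ofReal (b (E.orthogonalProjectionOnto t)) =
      liminf (fun n => ENNReal.ofReal (s n (F.orthogonalProjectionOnto t)) *
      ENNReal.ofReal (b (E.orthogonalProjectionOnto t))) atTop := fun t =>
    (ENNReal.Tendsto.mul_const (hlim _) (Or.inr ENNReal.ofReal_ne_top)).liminf_eq.symm
  change ∫⁻ t, ENNReal.ofReal (autoConvFourier W (F.orthogonalProjectionOnto t)).re *
      ENNReal.ofReal (b (E.orthogonalProjectionOnto t)) ∂ν ≤ _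
  simp_rw [h2]
  refine (lintegral_liminf_le fun n => ?_).trans ?_
  · exact ((hsc n).comp F.orthogonalProjectionOnto.continuous).measurable.ennreal_ofReal.mul
      (hbc.comp E.orthogonalProjectionOnto.continuous).measurable.ennreal_ofReal
  · refine (liminf_le_liminf (Eventually.of_forall h1)).trans ?_
    rw [liminf_const]
    rfl

/-- If `γ` is the image of `α ψ(x_F) I(dx)` under `p_E` and `ν` is the Fourier transform of `I`,
then the Fourier transform of `γ` is the image of `α² ψ̂(x_F⊥) ν(dx)` under the orthogonal
projection to `E`. -/
theorem isFourierTransform_of_lintegral_eq {I ν : Measure V} (hI : IsFourierTransform I ν)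
    (hvol : (volume : Measure V) = α •
      ((volume : Measure E).prod (volume : Measure F)).map fun p => (p.1 : V) + p.2)
    (hα0 : α ≠ 0) (hα : α ≠ ∞) {W : Set F} (hWb : IsBounded W) (hWm : MeasurableSet W)
    {γ : Measure E} (hγt : γ.HasTemperateGrowth)
    (hγ : ∀ g : E → ℝ≥0∞, Measurable g → ∫⁻ y, g y ∂γ =
      α * ∫⁻ x, ENNReal.ofReal (autoConv W (F.projectionOnto E hEF.symm x)) *
        g (E.projectionOnto F hEF x) ∂I) :
    IsFourierTransform γ (α ^ 2 • (ν.withDensity fun t =>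
      ENNReal.ofReal (autoConvFourier W (F.orthogonalProjectionOnto t)).re).map
        fun t => E.orthogonalProjectionOnto t) := by
  have hpE := measurable_projectionOnto hEF
  have hpF := measurable_projectionOnto hEF.symm
  have hPE : Measurable fun t : V => E.orthogonalProjectionOnto t :=
    E.orthogonalProjectionOnto.continuous.measurable
  let ω : V → ℝ := fun t => (autoConvFourier W (F.orthogonalProjectionOnto t)).re
  have hωm : Measurable ω := (Complex.continuous_re.comp ((continuous_autoConvFourier hWb hWm).comp
    F.orthogonalProjectionOnto.continuous)).measurable
  have hω0 : ∀ t, 0 ≤ ω t := fun t => by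
    simp only [ω]
    rw [autoConvFourier_eq hWb hWm, Complex.ofReal_re]
    positivity
  set γ' : Measure E := α ^ 2 • (ν.withDensity fun t => ENNReal.ofReal (ω t)).map
    fun t => E.orthogonalProjectionOnto t with hγ'
  obtain ⟨M, hM⟩ := exists_lintegral_autoConvFourier_le hEF hI hvol hα0 hα hWb hWm
  have hα2 : α ^ 2 ≠ ∞ := ENNReal.pow_ne_top hα
  have hγ't : γ'.HasTemperateGrowth := by
    refine TranslationBounded.hasTemperateGrowth (C := (α ^ 2).toNNReal * M) fun y => ?_
    have hB : MeasurableSet (Metric.closedBall y 1) := Metric.isClosed_closedBall.measurableSet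
    rw [hγ', Measure.smul_apply, Measure.map_apply hPE hB, withDensity_apply _ (hPE hB),
      ← lintegral_indicator (hPE hB), ENNReal.coe_mul, ENNReal.coe_toNNReal hα2, smul_eq_mul]
    refine mul_le_mul_right ((lintegral_mono fun t => ?_).trans (hM y)) _
    by_cases ht : E.orthogonalProjectionOnto t ∈ Metric.closedBall y 1
    · rw [ballBump_eq_one one_pos ht, ENNReal.ofReal_one, mul_one]
      exact indicator_le_self _ _ _
    · rw [indicator_of_notMem (by exact ht)]
      exact zero_le
  have hd : Measurable fun x => ENNReal.ofReal (autoConv W (F.projectionOnto E hEF.symm x)) :=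
    ((measurable_autoConv hWm).comp hpF).ennreal_ofReal
  have hγeq : γ = α • (I.withDensity fun x =>
      ENNReal.ofReal (autoConv W (F.projectionOnto E hEF.symm x))).map
        (E.projectionOnto F hEF) := by
    refine Measure.ext_of_lintegral _ fun g hg => ?_
    have hg' : Measurable fun x => g (E.projectionOnto F hEF x) := hg.comp hpE
    rw [hγ g hg, lintegral_smul_measure, lintegral_map hg hpE,
      lintegral_withDensity_eq_lintegral_mul _ hd hg']
    rfl
  refine ⟨hγt, hγ't, ?_⟩
  ext g
  change ∫ z, 𝓕 g z ∂γ = ∫ t, g t ∂γ'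
  -- Schwartz functions are integrable for `γ'`; this dominates the limit on the Fourier side.
  have hint : Integrable (fun t => (ω t : ℂ) * g (E.orthogonalProjectionOnto t)) ν := by
    have h1 := SchwartzMap.integrable (μ := γ') g
    rw [hγ', integrable_smul_measure (pow_ne_zero 2 hα0) hα2,
      integrable_map_measure g.continuous.aestronglyMeasurable hPE.aemeasurable,
      integrable_withDensity_iff_integrable_smul' hωm.ennreal_ofReal
        (Eventually.of_forall fun x => ENNReal.ofReal_lt_top)] at h1
    refine h1.congr (Eventually.of_forall fun t => ?_)
    simp only [Function.comp_apply]
    rw [ENNReal.toReal_ofReal (hω0 t), Complex.real_smul]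
  have hL : ∫ z, 𝓕 g z ∂γ = α.toReal * ∫ x, (autoConv W (F.projectionOnto E hEF.symm x) : ℂ) *
      𝓕 g (E.projectionOnto F hEF x) ∂I := by
    rw [hγeq, integral_smul_measure, integral_map hpE.aemeasurable
      (𝓕 g).continuous.aestronglyMeasurable, integral_withDensity_eq_integral_toReal_smul
        hd (Eventually.of_forall fun x => ENNReal.ofReal_lt_top), Complex.real_smul]
    congr 1
    refine integral_congr_ae (Eventually.of_forall fun x => ?_)
    simp only
    rw [ENNReal.toReal_ofReal (autoConv_nonneg hWm _), Complex.real_smul]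
  have hRt : ∫ t, g t ∂γ' =
      α.toReal ^ 2 * ∫ t, (ω t : ℂ) * g (E.orthogonalProjectionOnto t) ∂ν := by
    rw [hγ', integral_smul_measure, integral_map hPE.aemeasurable
      g.continuous.aestronglyMeasurable, integral_withDensity_eq_integral_toReal_smul
        hωm.ennreal_ofReal (Eventually.of_forall fun x => ENNReal.ofReal_lt_top),
      Complex.real_smul, ENNReal.toReal_pow, Complex.ofReal_pow]
    congr 1
    refine integral_congr_ae (Eventually.of_forall fun x => ?_)
    simp only
    rw [ENNReal.toReal_ofReal (hω0 x), Complex.real_smul]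
  obtain ⟨u, R, hR, hu, hu1, huR, huw, huF⟩ := exists_mollified_indicator hWb hWm
  have hR2 : 0 < 2 * R := by positivity
  have hum : ∀ n, Measurable (u n) := fun n => (hu n).continuous.measurable
  have hb := (integrable_autoCorr_bound hEF hI.choose hR2 (𝓕 g)).const_mul
    (volume.real (Metric.closedBall (0 : F) R))
  have hid := fun n => integral_autoCorr_mul_fourier hEF hI hvol (hu n) (hu1 n) (huR n) g hα0 hα
  have hlim1 : Tendsto (fun n => ∫ x, (autoCorr (u n) (F.projectionOnto E hEF.symm x) : ℂ) *
      𝓕 g (E.projectionOnto F hEF x) ∂I) atTop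
      (𝓝 (∫ x, (autoConv W (F.projectionOnto E hEF.symm x) : ℂ) *
        𝓕 g (E.projectionOnto F hEF x) ∂I)) := by
    refine tendsto_integral_of_dominated_convergence _ (fun n => ?_) hb
      (fun n => Eventually.of_forall fun x => ?_) (Eventually.of_forall fun x => ?_)
    · obtain ⟨Ψ, hΨ⟩ := exists_schwartz_autoCorr (hu n) (huR n)
      simp_rw [← hΨ]
      exact ((Ψ.continuous.measurable.comp hpF).mul
        ((𝓕 g).continuous.measurable.comp hpE)).aestronglyMeasurable
    · rw [norm_mul, ← mul_assoc]
      gcongr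
      exact norm_autoCorr_le_bumpAt (hu1 n) hR2 (huR n) _
    · rw [autoConv_eq_autoCorr]
      exact ((Complex.continuous_ofReal.tendsto _).comp
        (tendsto_autoCorr hum hu1 huR huw _)).mul_const _
  have hlim2 : Tendsto (fun n => ∫ t, ((‖𝓕 (fun x => (u n x : ℂ))
      (F.orthogonalProjectionOnto t)‖ ^ 2 : ℝ) : ℂ) * g (E.orthogonalProjectionOnto t) ∂ν) atTop
      (𝓝 (∫ t, (ω t : ℂ) * g (E.orthogonalProjectionOnto t) ∂ν)) := by
    refine tendsto_integral_of_dominated_convergence _ (fun n => (hid n).1.aestronglyMeasurable)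
      hint.norm (fun n => Eventually.of_forall fun t => ?_) (Eventually.of_forall fun t => ?_)
    · rw [norm_mul, norm_mul, Complex.norm_real, Complex.norm_real, Real.norm_of_nonneg (hω0 t)]
      simp only [ω]
      rw [autoConvFourier_eq hWb hWm, Complex.ofReal_re, Real.norm_of_nonneg (sq_nonneg _)]
      gcongr
      exact huF n _
    · refine ((Complex.continuous_ofReal.tendsto _).comp ?_).mul_const _
      simp only [ω]
      rw [autoConvFourier_eq hWb hWm, Complex.ofReal_re]
      exact (tendsto_fourier_of_dominated hum hu1 huR huw _).norm.pow 2
  have hfin := tendsto_nhds_unique hlim1 ((hlim2.const_mul (α.toReal : ℂ)).congr fun n =>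
    (hid n).2.symm)
  rw [hL, hRt, hfin]
  ring

end ProjectedMeasure

end PointProc

theorem theorem3 {d : ℕ} (E F : Submodule ℝ (EuclideanSpace ℝ (Fin d))) (hEF : IsCompl E F)
    (W : Set F) (hWb : Bornology.IsBounded W) (hWm : MeasurableSet W)
    {Ω : Type*} [MeasurableSpace Ω] (P : Measure Ω) [IsProbabilityMeasure P]
    (φ : Ω → PointProc.Config (EuclideanSpace ℝ (Fin d))) (hφ : Measurable φ)
    -- `φ` is stationary, square integrable, and ergodic under the translations by vectors of `E`
    (hstat : VAddInvariantMeasure (EuclideanSpace ℝ (Fin d))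
      (PointProc.Config (EuclideanSpace ℝ (Fin d))) (P.map φ))
    (hsq : PointProc.SquareIntegrable (P.map φ))
    (herg : ErgodicVAdd E (PointProc.Config (EuclideanSpace ℝ (Fin d))) (P.map φ))
    -- a.s., different points of `φ ∩ (E × W)` have different images by `p_E`
    (hinj : ∀ᵐ ω ∂P, Set.InjOn (E.projectionOnto F hEF)
      ((φ ω).1 ∩ {x | F.projectionOnto E hEF.symm x ∈ W}))
    -- the Borel sets used to compute the Palm measures of `φ` and of `χ`
    (B : Set (EuclideanSpace ℝ (Fin d))) (hBm : MeasurableSet B)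
    (hB0 : 0 < PointProc.lebesgue _ B) (hB1 : PointProc.lebesgue _ B < ∞)
    (B' : Set E) (hBm' : MeasurableSet B')
    (hB0' : 0 < PointProc.lebesgue _ B') (hB1' : PointProc.lebesgue _ B' < ∞)
    -- Borel sets of measure one in `E` and in `F`
    (CE : Set E) (hCEm : MeasurableSet CE) (hCE : PointProc.lebesgue _ CE = 1)
    (CF : Set F) (hCFm : MeasurableSet CF) (hCF : PointProc.lebesgue _ CF = 1) :
    let α : ℝ≥0∞ := PointProc.lebesgue (EuclideanSpace ℝ (Fin d))
      (((↑) : E → EuclideanSpace ℝ (Fin d)) '' CE + ((↑) : F → EuclideanSpace ℝ (Fin d)) '' CF)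
    let Qt : Measure (PointProc.Config (EuclideanSpace ℝ (Fin d))) := PointProc.palm B (P.map φ)
    let χ : Ω → PointProc.Config E := fun ω => PointProc.cutProject hEF hWb (φ ω)
    let Pt : Measure (PointProc.Config E) := PointProc.palm B' (P.map χ)
    let f : F × PointProc.Config (EuclideanSpace ℝ (Fin d)) → PointProc.Config E :=
      fun p => PointProc.cutProject hEF hWb ((p.1 : EuclideanSpace ℝ (Fin d)) +ᵥ p.2)
    let γ : Measure E := PointProc.intensity Pt
    -- 1. `χ` is a stationary, ergodic and square integrable point process on `E`
    (Measurable χ ∧ VAddInvariantMeasure E (PointProc.Config E) (P.map χ) ∧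
      ErgodicVAdd E (PointProc.Config E) (P.map χ) ∧ PointProc.SquareIntegrable (P.map χ)) ∧
    -- 2. its Palm measure
    (Measurable f ∧
      Pt = Measure.map f (α • ((PointProc.lebesgue F).restrict W).prod Qt)) ∧
    -- 3. the intensity of its Palm measure
    (∀ C : Set E, MeasurableSet C →
      γ C = α * ∫⁻ x, ENNReal.ofReal (PointProc.autoConv W (F.projectionOnto E hEF.symm x)) *
        C.indicator (fun _ => (1 : ℝ≥0∞)) (E.projectionOnto F hEF x) ∂(PointProc.intensity Qt)) ∧
    -- 4. the Fourier transform of that intensity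
    ((∀ ξ : F, (PointProc.autoConvFourier W ξ).im = 0 ∧ 0 ≤ (PointProc.autoConvFourier W ξ).re) ∧
      (∃ ν : Measure (EuclideanSpace ℝ (Fin d)),
        PointProc.IsFourierTransform (PointProc.intensity Qt) ν) ∧
      ∀ ν : Measure (EuclideanSpace ℝ (Fin d)),
        PointProc.IsFourierTransform (PointProc.intensity Qt) ν →
        ∃ γ' : Measure E, PointProc.IsFourierTransform γ γ' ∧
          ∀ C : Set E, MeasurableSet C →
            γ' C = α ^ 2 * ∫⁻ x,
              ENNReal.ofReal (PointProc.autoConvFourier W (F.orthogonalProjectionOnto x)).re *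
                C.indicator (fun _ => (1 : ℝ≥0∞)) (E.orthogonalProjectionOnto x) ∂ν) := by
  intro α Qt χ Pt f γ
  set Q := P.map φ with hQ
  have hQp : IsProbabilityMeasure Q := Measure.isProbabilityMeasure_map hφ.aemeasurable
  rw [PointProc.lebesgue_eq_volume] at hB0 hB1 hB0' hB1' hCE hCF
  have hc := PointProc.measurable_cutProject hEF hWb hWm
  have hχ : P.map χ = Q.map (PointProc.cutProject hEF hWb) := (Measure.map_map hc hφ).symm
  have hinj' : ∀ᵐ ψ ∂Q, ψ ∈ PointProc.injConfigs hEF W :=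
    (ae_map_iff hφ.aemeasurable (PointProc.measurableSet_injConfigs hEF hWb hWm)).2 hinj
  have hinv : ∀ t : E, Q.map (fun ψ => (t : EuclideanSpace ℝ (Fin d)) +ᵥ ψ) = Q := fun t =>
    PointProc.map_vadd_eq hstat t
  obtain ⟨hα0, hα1, hvol⟩ := PointProc.volume_eq_smul_map hEF hCE hCF hCEm hCFm
  have hα : α = PointProc.sumVolume CE CF := by
    simp only [α, PointProc.lebesgue_eq_volume, PointProc.sumVolume]
  rw [← hα] at hα0 hα1 hvol
  have hstat' := PointProc.vaddInvariant_map_cutProject hEF hWb hWm hinv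
  have hsq' := PointProc.squareIntegrable_map_cutProject hEF hWb hWm hsq
  have hQp' : IsProbabilityMeasure (Q.map (PointProc.cutProject hEF hWb)) :=
    Measure.isProbabilityMeasure_map hc.aemeasurable
  have hγ : γ = PointProc.intensity (PointProc.palm B' (Q.map (PointProc.cutProject hEF hWb))) := by
    simp only [γ, Pt, hχ]
  have hγI : ∀ g : E → ℝ≥0∞, Measurable g → ∫⁻ y, g y ∂γ = α * ∫⁻ x, ENNReal.ofReal
      (PointProc.autoConv W (F.projectionOnto E hEF.symm x)) *
        g (E.projectionOnto F hEF x) ∂(PointProc.intensity Qt) := fun g hg => by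
    rw [hγ]
    exact PointProc.intensity_palm_map_cutProject hWb hWm hstat hsq hBm hB0 hB1 hBm' hB0' hB1'
      hα0 hvol hinj' hg
  refine ⟨⟨hc.comp hφ, ?_, ?_, ?_⟩, ⟨PointProc.measurable_cutProject_vadd hWb hWm, ?_⟩,
    fun C hC => ?_, fun ξ => ?_, ?_, fun ν hν => ?_⟩
  · rw [hχ]
    exact hstat'
  · rw [hχ]
    exact PointProc.ergodicVAdd_map_cutProject hEF hWb hWm herg hstat'
  · rw [hχ]
    exact hsq'
  · simp only [Pt, hχ, PointProc.lebesgue_eq_volume]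
    exact PointProc.palm_map_cutProject hWb hWm hstat hsq hBm hB0 hB1 hBm' hB0' hB1' hvol hinj'
  · rw [← hγI _ (measurable_const.indicator hC), lintegral_indicator hC, setLIntegral_one]
  · rw [PointProc.autoConvFourier_eq hWb hWm, Complex.ofReal_im, Complex.ofReal_re]
    exact ⟨rfl, by positivity⟩
  · exact PointProc.exists_isFourierTransform_intensity_palm hstat hsq hBm hB0 hB1
  · obtain ⟨K, hK⟩ :=
      PointProc.exists_intensity_palm_closedBall_le hstat' hsq' hBm' hB0' hB1'
    have hγt : γ.HasTemperateGrowth := by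
      rw [hγ]
      exact PointProc.TranslationBounded.hasTemperateGrowth hK
    refine ⟨_, PointProc.isFourierTransform_of_lintegral_eq hEF hν hvol hα0 hα1 hWb hWm hγt
      hγI, fun C hC => ?_⟩
    have hPE : Measurable fun t : EuclideanSpace ℝ (Fin d) => E.orthogonalProjectionOnto t :=
      E.orthogonalProjectionOnto.continuous.measurable
    rw [Measure.smul_apply, Measure.map_apply hPE hC, withDensity_apply _ (hPE hC),
      ← lintegral_indicator (hPE hC), smul_eq_mul]
    congr 1
    refine lintegral_congr fun t => ?_
    by_cases ht : E.orthogonalProjectionOnto t ∈ C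
    · rw [indicator_of_mem (by exact ht), indicator_of_mem ht, mul_one]
    · rw [indicator_of_notMem (by exact ht), indicator_of_notMem ht, mul_zero]
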